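/- **Conventions.** A graph is a connected, locally finite, undirected graph $X$ with at least one edge; multiple edges and loops are allowed. A loop counts once in $\deg$, $p(x,y)=\#\{\text{edges from }x\text{ to }y\}/\deg(x)$ is the transition probability of the simple random walk, $p^n$ is the $n$-step transition probability, and $\mathbb{P}_x$ is the law of the simple random walk $(x_0,x_1,\dots)$ started at $x$. The space of isomorphism classes of rooted graphs carries the Borel $\sigma$-algebra of the local topology (convergence means that, for each $r$, the isomorphism type of the ball of radius $r$ around the root is eventually constant), and similarly for the space of rooted graphs with a path starting at the root. A random rooted graph $(X,x)$ is a random element of the first space, and the simple random walk on it is the random element $(X,x,(x_n)_{n\ge0})$ of the second space for which $(x_n)$ has conditional law $\mathbb{P}_x$ given $(X,x)$. The random graph is *stationary* if $(X,x_1)$ has the same law as $(X,x)$, and it is *ergodic* if the law of $(X,x,(x_n))$ is an ergodic invariant measure for the shift $(X,x,(x_0,x_1,\dots))\mapsto(X,x_1,(x_1,x_2,\dots))$. For $m\in\mathbb{N}$ let $\mathcal F_m=\sigma(x_0,\dots,x_m)$ and let $\mathcal F^\infty=\bigcap_n\sigma(x_n,x_{n+1},\dots)$ be the tail $\sigma$-algebra.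 Let $\widehat{\mathbb P}_x$ be the image of $\mathbb P_x$ under $\omega\mapsto(\omega,\omega)$. With $\varphi(t)=t\log t$ and $\varphi(0)=0$, put $$I_m^\infty(X,x)=\sup\sum_i\varphi\!\left(\frac{\widehat{\mathbb P}_x(A_i)}{(\mathbb P_x\times\mathbb P_x)(A_i)}\right)(\mathbb P_x\times\mathbb P_x)(A_i),$$ where the supremum is over all finite partitions $\{A_i\}$ of the product of two copies of the path space into sets of $\sigma(\mathcal F_m\times\mathcal F^\infty)$, and terms with $(\mathbb P_x\times\mathbb P_x)(A_i)=0$ are $0$. **Statement.** Let $(X,x)$ be an ergodic stationary random graph with finite entropy, in the sense that $\liminf_{n\to\infty}\frac1n\mathbb E\left(-\log p^n(x_0,x_n)\right)<+\infty$ (for instance, with $\mathbb E(\log\deg(x))<+\infty$). Then its entropy $$h(X,x)=\lim_{n\to\infty}-\frac1n\log p^n(x_0,x_n)$$ exists almost surely and in $L^1$ as a finite constant, and for every integer $m\ge1$ $$h(X,x)=\mathbb E\left(\frac1m I_m^\infty(X,x)\right).$$ -/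

import Mathlib

open MeasureTheory ProbabilityTheory Filter Topology
open scoped ENNReal

noncomputable section

namespace StatGraph

/-! ### Graphs, with multiple edges and loops -/

/-- An undirected multigraph, recorded by its edge multiplicities: `mult x y` is the number of edges
connecting `x` to `y`, and `mult x x` is the number of loops at `x`. -/
structure Multigraph where
  V : Type
  mult : V → V → ℕ
  mult_comm : ∀ x y, mult x y = mult y x

/-- The simple graph underlying a multigraph; it is used for connectedness and graph distance. -/
def Multigraph.simple (G : Multigraph) : SimpleGraph G.V where
  Adj x y := x ≠ y ∧ G.mult x y ≠ 0
  symm := ⟨fun x y h => ⟨h.1.symm, by rw [G.mult_comm]; exact h.2⟩⟩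
  loopless := ⟨fun _ h => h.1 rfl⟩

/-- A connected locally finite graph.  The one graph without edges (a single vertex without loops),
on which there is no simple random walk, is excluded by `exists_edge`.  As these graphs are
countable, each of them has a copy whose vertex set is in `Type`. -/
structure LFGraph extends Multigraph where
  finite_nbrs : ∀ x, {y | mult x y ≠ 0}.Finite
  connected : toMultigraph.simple.Connected
  exists_edge : ∀ x, ∃ y, mult x y ≠ 0

namespace LFGraph

variable (G : LFGraph)

/-- The neighbours of `x` (including `x` itself if there is a loop at `x`). -/
def nbrs (x : G.V) : Finset G.V := (G.finite_nbrs x).toFinset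

/-- The degree; a loop is counted once. -/
def deg (x : G.V) : ℕ := ∑ y ∈ G.nbrs x, G.mult x y

/-- The one-step transition probability of the simple random walk. -/
def p (x y : G.V) : ℝ := (G.mult x y : ℝ) / (G.deg x : ℝ)

open Classical in
/-- The `n`-step transition probability of the simple random walk. -/
def pn : ℕ → G.V → G.V → ℝ
  | 0, x, y => if x = y then 1 else 0
  | n + 1, x, y => ∑ z ∈ G.nbrs x, G.p x z * pn n z y

theorem deg_pos (x : G.V) : 0 < G.deg x := by
  obtain ⟨y, hy⟩ := G.exists_edge x
  have hmem : y ∈ G.nbrs x := by simpa [nbrs] using hy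
  exact lt_of_lt_of_le (Nat.pos_of_ne_zero hy)
    (Finset.single_le_sum (f := fun z => G.mult x z) (fun _ _ => Nat.zero_le _) hmem)

theorem sum_p (x : G.V) : ∑ y ∈ G.nbrs x, ENNReal.ofReal (G.p x y) = 1 := by
  have hd : (G.deg x : ℝ) ≠ 0 := by exact_mod_cast (G.deg_pos x).ne'
  rw [← ENNReal.ofReal_sum_of_nonneg fun y _ => by unfold p; positivity]
  have h : ∑ y ∈ G.nbrs x, G.p x y = 1 := by
    simp only [p, ← Finset.sum_div]
    rw [div_eq_one_iff_eq hd]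
    simp [deg]
  simp [h]

theorem p_eq_zero (x y : G.V) (h : y ∉ G.nbrs x) : ENNReal.ofReal (G.p x y) = 0 := by
  have h' : G.mult x y = 0 := by simpa [nbrs] using h
  simp [p, h']

/-- The distribution `p x ·` of one step from `x`. -/
def stepPMF (x : G.V) : PMF G.V :=
  PMF.ofFinset (fun y => ENNReal.ofReal (G.p x y)) (G.nbrs x) (G.sum_p x) (G.p_eq_zero x)

/-- The vertex set is discrete. -/
instance : MeasurableSpace G.V := ⊤

/-- Given the vertices visited up to time `n`, the next vertex has the distribution `p (h n) ·`. -/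
def stepKernel (n : ℕ) : Kernel ((i : Finset.Iic n) → G.V) G.V where
  toFun h := (G.stepPMF (h ⟨n, Finset.mem_Iic.2 le_rfl⟩)).toMeasure
  measurable' := (measurable_from_top (f := fun v : G.V => (G.stepPMF v).toMeasure)).comp
    (measurable_pi_apply _)

instance (n : ℕ) : IsMarkovKernel (G.stepKernel n) :=
  ⟨fun _ => PMF.toMeasure.isProbabilityMeasure _⟩

/-- The distribution of the simple random walk starting at `x`, as a measure on sequences of
vertices (it is carried by the paths of the graph). -/
def walkFrom (x : G.V) : Measure (ℕ → G.V) :=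
  Kernel.traj (X := fun _ => G.V) G.stepKernel 0 (fun _ => x)

/-- The σ-algebra generated by `x_0, …, x_m`. -/
abbrev past (m : ℕ) : MeasurableSpace (ℕ → G.V) :=
  ⨆ i : {i : ℕ // i ≤ m}, MeasurableSpace.comap (fun ω => ω i.1) ⊤

/-- The σ-algebra generated by `x_n, x_{n+1}, …`. -/
abbrev future (n : ℕ) : MeasurableSpace (ℕ → G.V) :=
  ⨆ i : {i : ℕ // n ≤ i}, MeasurableSpace.comap (fun ω => ω i.1) ⊤

/-- The tail σ-algebra. -/
abbrev tail : MeasurableSpace (ℕ → G.V) := ⨅ n, G.future n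

end LFGraph

/-! ### Mutual information -/

/-- A finite partition (some cells may be empty) into sets of the σ-algebra `m`. -/
structure IsFinPartition {Ω : Type*} (m : MeasurableSpace Ω) {k : ℕ} (A : Fin k → Set Ω) :
    Prop where
  measurable : ∀ i, MeasurableSet[m] (A i)
  disjoint : Pairwise fun i j => Disjoint (A i) (A j)
  cover : ⋃ i, A i = Set.univ

/-- The function `t log t`, with value `0` at `0`. -/
def phi (t : ℝ) : ℝ := t * Real.log t

/-- The sum attached to a finite family of sets: the image of `P` under `ω ↦ (ω, ω)` is the
law of two identical copies, `P.prod P` that of two independent copies. -/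
def partitionSum {Ω : Type*} [MeasurableSpace Ω] (P : Measure Ω) {k : ℕ}
    (A : Fin k → Set (Ω × Ω)) : ℝ :=
  ∑ i, phi ((P.map fun ω => (ω, ω)).real (A i) / (P.prod P).real (A i)) * (P.prod P).real (A i)

/-- The mutual information of two σ-algebras: the supremum of the partition sums over the finite
partitions into sets of the product σ-algebra.  As the partition `{univ}` gives `0`, taking
`ENNReal.ofReal` of the sums does not change the supremum. -/
def mutualInfo {Ω : Type*} (m₁ m₂ : MeasurableSpace Ω) [MeasurableSpace Ω] (P : Measure Ω) :
    ℝ≥0∞ :=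
  ⨆ (k : ℕ) (A : Fin k → Set (Ω × Ω)) (_ : IsFinPartition (m₁.comap Prod.fst ⊔ m₂.comap Prod.snd) A),
    ENNReal.ofReal (partitionSum P A)

/-! ### Rooted graphs and rooted graphs with a path -/

/-- A rooted graph. -/
structure RootedGraph extends LFGraph where
  root : V

/-- A rooted graph with a path starting at the root. -/
structure RootedPath extends RootedGraph where
  path : ℕ → V
  path_zero : path 0 = root
  path_adj : ∀ n, mult (path n) (path (n + 1)) ≠ 0

namespace RootedGraph

/-- The mutual information between the first `m` steps and the tail of the simple random walk
started at the root. -/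
def infoTail (m : ℕ) (G : RootedGraph) : ℝ≥0∞ :=
  mutualInfo (G.past m) G.tail (G.walkFrom G.root)

/-- The set of vertices of the ball of radius `r` around the root. -/
def ball (G : RootedGraph) (r : ℕ) : Set G.V := {y | G.simple.dist G.root y ≤ r}

/-- A bijection between the balls of radius `r` which is an isomorphism of rooted graphs. -/
def IsBallIso {r : ℕ} (G H : RootedGraph) (e : G.ball r ≃ H.ball r) : Prop :=
  (∀ u : G.ball r, (u : G.V) = G.root → (e u : H.V) = H.root) ∧
    ∀ u v : G.ball r, H.mult (e u) (e v) = G.mult u v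

/-- The balls of radius `r` around the roots are isomorphic. -/
def SameBall (r : ℕ) (G H : RootedGraph) : Prop :=
  ∃ e : G.ball r ≃ H.ball r, IsBallIso G H e

/-- The Borel σ-algebra of the local topology on rooted graphs: it is generated by the (basic open,
up to isomorphism countably many) events "the ball of radius `r` is isomorphic to that of `H`".
All its sets are invariant under isomorphism, so a measure for this σ-algebra is the same thing as a
Borel measure on the space of isomorphism classes of rooted graphs. -/
instance : MeasurableSpace RootedGraph :=
  MeasurableSpace.generateFrom {S | ∃ (r : ℕ) (H : RootedGraph), S = {G | SameBall r G H}}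

/-- The paths starting at the root, as sequences of vertices. -/
def Paths (G : RootedGraph) : Set (ℕ → G.V) :=
  {ω | ω 0 = G.root ∧ ∀ n, G.mult (ω n) (ω (n + 1)) ≠ 0}

/-- The rooted graph `G` together with a path in it. -/
def withPath (G : RootedGraph) (ω : G.Paths) : RootedPath where
  toRootedGraph := G
  path := ω.1
  path_zero := ω.2.1
  path_adj := ω.2.2

end RootedGraph

namespace RootedPath

/-- The balls of radius `r` are isomorphic through an isomorphism which maps the first `r` steps of
one path to the first `r` steps of the other (these steps lie in the balls). -/
def SameBall (r : ℕ) (w v : RootedPath) : Prop :=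
  ∃ e : w.ball r ≃ v.ball r, RootedGraph.IsBallIso w.toRootedGraph v.toRootedGraph e ∧
    ∀ (u : w.ball r) (i : ℕ), i ≤ r → (u : w.V) = w.path i → (e u : v.V) = v.path i

/-- The Borel σ-algebra of the local topology on rooted graphs with a path.  As before, its sets are
invariant under isomorphism. -/
instance : MeasurableSpace RootedPath :=
  MeasurableSpace.generateFrom {S | ∃ (r : ℕ) (v : RootedPath), S = {w | SameBall r w v}}

/-- The graph re-rooted at the first step of the path. -/
def reroot (w : RootedPath) : RootedGraph where
  toLFGraph := w.toLFGraph
  root := w.path 1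

/-- The shift `(X, x, (x_0, x_1, x_2, …)) ↦ (X, x_1, (x_1, x_2, …))`. -/
def shift (w : RootedPath) : RootedPath where
  toRootedGraph := w.reroot
  path n := w.path (n + 1)
  path_zero := rfl
  path_adj n := w.path_adj (n + 1)

/-- The random variable `-log p^n(x_0, x_n)`. -/
def negLog (n : ℕ) (w : RootedPath) : ℝ := -Real.log (w.pn n (w.path 0) (w.path n))

end RootedPath

/-! ### Stationary random graphs and their entropy -/

/-- The law of `(G, G.root, (x_0, x_1, …))` for the simple random walk on the fixed graph `G`. -/
def walkOn (G : RootedGraph) : Measure RootedPath :=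
  ((G.walkFrom G.root).comap (Subtype.val : G.Paths → (ℕ → G.V))).map G.withPath

/-- The law of the simple random walk on a random rooted graph with law `μ`. -/
def walkLaw (μ : Measure RootedGraph) : Measure RootedPath := μ.bind walkOn

/-- `(X, x)` and `(X, x_1)` have the same law. -/
def IsStationary (μ : Measure RootedGraph) : Prop := (walkLaw μ).map RootedPath.reroot = μ

/-- The law of the simple random walk is an ergodic invariant measure for the shift. -/
def IsErgodic (μ : Measure RootedGraph) : Prop := Ergodic RootedPath.shift (walkLaw μ)

/-- The expectation of `-log p^n(x_0, x_n)`. -/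
def meanEntropy (μ : Measure RootedGraph) (n : ℕ) : ℝ≥0∞ :=
  ∫⁻ w, ENNReal.ofReal (w.negLog n) ∂walkLaw μ

/-- The entropy is finite: the means of `-(1/n) log p^n(x_0, x_n)` do not tend to infinity. -/
def FiniteEntropy (μ : Measure RootedGraph) : Prop :=
  liminf (fun n : ℕ => meanEntropy μ n / (n : ℝ≥0∞)) atTop < ∞

/-- `h` is the entropy: `-(1/n) log p^n(x_0, x_n)` converges to `h` almost surely and in `L¹`. -/
def IsEntropy (μ : Measure RootedGraph) (h : ℝ) : Prop :=
  (∀ᵐ w ∂walkLaw μ, Tendsto (fun n : ℕ => w.negLog n / (n : ℝ)) atTop (𝓝 h)) ∧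
    Tendsto (fun n : ℕ => eLpNorm (fun w => w.negLog n / (n : ℝ) - h) 1 (walkLaw μ)) atTop (𝓝 0)

end StatGraph

end

/-! Put `a n` for the mean of `-log p^n(x_0, x_n)`. Two facts about the increments of `a` give the
result.

Existence of the entropy is Kingman's theorem. The inequality p^n(x,y) p^m(y,z) ≤ p^(n+m)(x,z) makes
`negLog` a nonnegative subadditive cocycle over the shift (`negLog_add_le`), so
`SubadditiveErgodic.exists_tendsto` applies once `a 1` is finite. Its proof uses only nonnegativity
and ergodicity: the lower limit of the averages is invariant, hence a constant c; almost every orbit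
is covered by short segments of average cost close to c, and the cost of the uncovered visits is
controlled by the maximal inequality.

The information formula comes from an explicit density. On a fixed graph, the Markov property shows
that on σ(x_0,…,x_m) × σ(x_(m+k),…) the diagonal law has density p^k(x_m, y_(m+k)) / p^(m+k)(x,
y_(m+k)) with respect to the product law (`isBddDensity_infoDensity`). Mutual information is the
integral of `phi` of the density (`mutualInfo_eq`), which here is the mean of -log p^(m+k)(x,
x_(m+k)) minus that of -log p^k(x_m, x_(m+k)) (`info_eq`). Averaged over the random graph, with
shift invariance, this difference is a (m+k) - a k (`lintegral_info_add`). As information is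
nonnegative, `a` is nondecreasing, so the finite lower limit forces `a 1` to be finite.

As k grows the densities form a bounded reverse martingale. They converge along subsequences to a
density on σ(x_0,…,x_m) × tail, so the information tends to that of the tail (`tendsto_info`).
Domination by the mean of -log p^m permits averaging over the graph: a (m+k) - a k tends to the mean
of I_m^∞. Since a n / n tends to h, summing increments in steps of m identifies this limit as m h.

The remaining work is measurability in the local topology: functions of finite balls take countably
many values up to isomorphism, and the law of r steps depends only on the ball of radius r. -/

/-! ### Subadditive ergodic theorem for nonnegative sequences -/

namespace SubadditiveErgodic

variable {Ω : Type*} {T : Ω → Ω}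

/-- The running maximum `max_{0 ≤ n ≤ N} (S_n g - n η)` of the Birkhoff sums of `g - η`. -/
noncomputable def runningMax (T : Ω → Ω) (g : Ω → ℝ) (η : ℝ) : ℕ → Ω → ℝ
  | 0, _ => 0
  | N + 1, w => max 0 (g w - η + runningMax T g η N (T w))

theorem runningMax_nonneg (g : Ω → ℝ) (η : ℝ) (N : ℕ) (w : Ω) : 0 ≤ runningMax T g η N w := by
  cases N with
  | zero => exact le_rfl
  | succ N => exact le_max_left _ _

theorem runningMax_le_succ (g : Ω → ℝ) (η : ℝ) (N : ℕ) (w : Ω) :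
    runningMax T g η N w ≤ runningMax T g η (N + 1) w := by
  induction N generalizing w with
  | zero => exact runningMax_nonneg _ _ _ _
  | succ N ih =>
    rw [runningMax, runningMax]
    exact max_le_max le_rfl (by linarith [ih (T w)])

theorem birkhoffSum_le_runningMax (g : Ω → ℝ) (η : ℝ) (N : ℕ) (w : Ω) {n : ℕ} (hn : n ≤ N) :
    birkhoffSum T g n w - n * η ≤ runningMax T g η N w := by
  induction N generalizing n w with
  | zero => simp [Nat.le_zero.1 hn, runningMax]
  | succ N ih =>
    cases n with
    | zero => simpa using runningMax_nonneg g η (N + 1) w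
    | succ n =>
      rw [birkhoffSum_succ', runningMax]
      refine le_trans ?_ (le_max_right _ _)
      have := ih (T w) (Nat.succ_le_succ_iff.1 hn)
      push_cast
      linarith

/-- If, off `D`, some initial segment of length at most `N` has average cost at most `c`,
then a subadditive sequence grows with slope `c` up to the contribution of the visits to `D`. -/
theorem le_of_covering {f : ℕ → Ω → ℝ} (hf0 : ∀ w, f 0 w = 0) (hpos : ∀ n w, 0 ≤ f n w)
    (hsub : ∀ n m w, f (n + m) w ≤ f n w + f m (T^[n] w)) {c : ℝ} (hc : 0 ≤ c) {N : ℕ}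
    {D : Set Ω} (hD : ∀ w, w ∉ D → f 1 w ≤ N ∧ ∃ j : ℕ, 1 ≤ j ∧ j ≤ N ∧ f j w ≤ j * c)
    (n : ℕ) (w : Ω) :
    f n w ≤ n * c + birkhoffSum T (D.indicator (f 1)) n w + N * min (n : ℝ) N := by
  induction n using Nat.strong_induction_on generalizing w with
  | _ n ih =>
  rcases Nat.eq_zero_or_pos n with rfl | hn
  · simp [hf0]
  have hind : ∀ k w, 0 ≤ birkhoffSum T (D.indicator (f 1)) k w := fun k w =>
    Finset.sum_nonneg fun i _ => Set.indicator_nonneg (fun w _ => hpos 1 w) _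
  have hN : (0 : ℝ) ≤ N := N.cast_nonneg
  obtain ⟨k, rfl⟩ : ∃ k, n = k + 1 := ⟨n - 1, by omega⟩
  have hstep : f (k + 1) w ≤ f 1 w + f k (T w) := by
    simpa [add_comm] using hsub 1 k w
  have hk := ih k (by omega) (T w)
  -- A start in `D` advances by one step, charged to the Birkhoff sum. A start off `D` jumps over a
  -- whole cheap segment if it fits.
  by_cases hw : w ∈ D
  · rw [birkhoffSum_succ', Set.indicator_of_mem hw]
    have : (N : ℝ) * min (k : ℝ) N ≤ N * min ((k + 1 : ℕ) : ℝ) N := by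
      gcongr
      simp
    push_cast at this ⊢
    linarith
  · obtain ⟨h1, j, hj1, hjN, hj⟩ := hD w hw
    rcases le_or_gt j (k + 1) with hjk | hjk
    · obtain ⟨i, hi⟩ := Nat.exists_eq_add_of_le hjk
      have h2 := ih i (by omega) (T^[j] w)
      have h3 := hsub j i w
      rw [← hi] at h3
      have h4 : birkhoffSum T (D.indicator (f 1)) (k + 1) w =
          birkhoffSum T (D.indicator (f 1)) j w +
            birkhoffSum T (D.indicator (f 1)) i (T^[j] w) := by
        rw [hi, birkhoffSum_add]
      have h5 : (N : ℝ) * min (i : ℝ) N ≤ N * min ((k + 1 : ℕ) : ℝ) N := by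
        gcongr
        omega
      have h6 : ((k + 1 : ℕ) : ℝ) = j + i := by exact_mod_cast hi
      rw [h4, h6]
      rw [h6] at h5
      linarith [hind j w]
    -- The cheap segment overruns the horizon, so at most `N` steps remain. This step costs at most
    -- `N`, exactly the growth of `N * min n N` in that range.
    · have hkN : (k : ℝ) + 1 ≤ N := by
        exact_mod_cast (by omega : k + 1 ≤ N)
      rw [birkhoffSum_succ', Set.indicator_of_notMem hw]
      push_cast
      rw [min_eq_left hkN]
      rw [min_eq_left (by linarith)] at hk
      linarith

variable {f : ℕ → Ω → ℝ}

theorem le_birkhoffSum (hf0 : ∀ w, f 0 w = 0)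
    (hsub : ∀ n m w, f (n + m) w ≤ f n w + f m (T^[n] w)) (n : ℕ) (w : Ω) :
    f n w ≤ birkhoffSum T (f 1) n w := by
  induction n with
  | zero => simp [hf0]
  | succ n ih =>
    rw [birkhoffSum_succ]
    linarith [hsub n 1 w]

/-- The lower limit of the averages of a subadditive sequence does not decrease along orbits. -/
theorem liminf_le_liminf_comp (hpos : ∀ n w, 0 ≤ f n w)
    (hsub : ∀ n m w, f (n + m) w ≤ f n w + f m (T^[n] w)) (w : Ω) :
    liminf (fun n : ℕ => ENNReal.ofReal (f n w / n)) atTop ≤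
      liminf (fun n : ℕ => ENNReal.ofReal (f n (T w) / n)) atTop := by
  refine le_of_forall_gt fun b hb => ?_
  obtain ⟨a, ha, hab⟩ := exists_between hb
  obtain ⟨b', hab', hb'⟩ := exists_between hab
  have ha_top : a ≠ ⊤ := (lt_of_lt_of_le hab le_top).ne
  have hb'_top : b' ≠ ⊤ := (lt_of_lt_of_le hb' le_top).ne
  refine lt_of_le_of_lt ?_ hb'
  -- The gap between `a` and `b'`, multiplied by a large `n`, absorbs the extra first step `f 1 w`.
  have hlt : a.toReal < b'.toReal := (ENNReal.toReal_lt_toReal ha_top hb'_top).2 hab'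
  have hfreq : ∃ᶠ n : ℕ in atTop, ENNReal.ofReal (f n (T w) / n) < a :=
    frequently_lt_of_liminf_lt (by isBoundedDefault) ha
  have hlarge : ∀ᶠ n : ℕ in atTop, f 1 w ≤ n * (b'.toReal - a.toReal) ∧ 1 ≤ n := by
    refine Filter.Eventually.and ?_ (eventually_ge_atTop 1)
    have := tendsto_natCast_atTop_atTop (R := ℝ) |>.atTop_mul_const (sub_pos.2 hlt)
    exact this.eventually_ge_atTop _
  have hfreq2 : ∃ᶠ n : ℕ in atTop, ENNReal.ofReal (f n w / n) ≤ b' := by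
    rw [frequently_atTop] at hfreq ⊢
    obtain ⟨n0, hn0⟩ := eventually_atTop.1 hlarge
    intro k
    obtain ⟨n, hn, hna⟩ := hfreq (max k n0)
    obtain ⟨hn1, hn2⟩ := hn0 n (le_of_max_le_right hn)
    refine ⟨n + 1, (le_of_max_le_left hn).trans (Nat.le_succ n), ?_⟩
    have hn' : (0 : ℝ) < n := by exact_mod_cast hn2
    rw [ENNReal.ofReal_lt_iff_lt_toReal (div_nonneg (hpos _ _) hn'.le) ha_top,
      div_lt_iff₀ hn'] at hna
    refine ENNReal.ofReal_le_of_le_toReal ?_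
    have h1 : f (n + 1) w ≤ f 1 w + f n (T w) := by
      simpa [add_comm] using hsub 1 n w
    rw [div_le_iff₀ (by positivity)]
    push_cast
    nlinarith [ENNReal.toReal_nonneg (a := b')]
  exact liminf_le_of_frequently_le hfreq2 (by isBoundedDefault)

/-! ### Maximal inequality and convergence for measure-preserving maps. -/

variable [MeasurableSpace Ω] {P : Measure Ω}

theorem integral_comp_of_measurePreserving (hT : MeasurePreserving T P P) {g : Ω → ℝ}
    (hg : AEStronglyMeasurable g P) : ∫ w, g (T w) ∂P = ∫ w, g w ∂P := by
  have h := integral_map hT.measurable.aemeasurable (f := g) (by rwa [hT.map_eq])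
  rw [hT.map_eq] at h
  exact h.symm

theorem integrable_runningMax [IsFiniteMeasure P] (hT : MeasurePreserving T P P) {g : Ω → ℝ}
    (hg : Integrable g P) (η : ℝ) (N : ℕ) : Integrable (runningMax T g η N) P := by
  induction N with
  | zero => exact integrable_zero _ _ _
  | succ N ih =>
    exact (integrable_zero _ _ _).sup
      ((hg.sub (integrable_const η)).add (hT.integrable_comp_of_integrable ih))

theorem measurable_runningMax (hT : Measurable T) {g : Ω → ℝ}
    (hg : Measurable g) (η : ℝ) (N : ℕ) : Measurable (runningMax T g η N) := by
  induction N with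
  | zero => exact measurable_const
  | succ N ih =>
    exact measurable_const.max ((hg.sub measurable_const).add (ih.comp hT))

/-- Garsia's argument. Where the running maximum M is positive it is at most g - η + M ∘ T, and
elsewhere it vanishes, hence is at most M ∘ T. On integration the two terms in M cancel by
invariance. -/
theorem mul_measure_runningMax_pos_le [IsFiniteMeasure P] (hT : MeasurePreserving T P P)
    {g : Ω → ℝ} (hgm : Measurable g) (hg : Integrable g P) (h0 : ∀ w, 0 ≤ g w) (η : ℝ) (N : ℕ) :
    η * P.real {w | 0 < runningMax T g η N w} ≤ ∫ w, g w ∂P := by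
  set A := {w | 0 < runningMax T g η N w}
  have hA : MeasurableSet A :=
    measurableSet_lt measurable_const (measurable_runningMax hT.measurable hgm η N)
  have hi := integrable_runningMax hT hg η N
  have hgi : Integrable (fun w => g w - η) P := hg.sub (integrable_const η)
  have hpt : ∀ w, runningMax T g η N w ≤
      A.indicator (fun w => g w - η) w + runningMax T g η N (T w) := by
    intro w
    by_cases hw : w ∈ A
    · rw [Set.indicator_of_mem hw]
      have hw' : 0 < runningMax T g η N w := hw
      cases N with
      | zero => simp [runningMax] at hw'
      | succ N =>
        have h1 := runningMax_le_succ (T := T) g η N (T w)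
        rw [runningMax] at hw' ⊢
        rcases le_total (g w - η + runningMax T g η N (T w)) 0 with h | h
        · rw [max_eq_left h] at hw'
          exact absurd hw' (lt_irrefl _)
        · rw [max_eq_right h]
          linarith
    · rw [Set.indicator_of_notMem hw, zero_add]
      exact (not_lt.1 hw).trans (runningMax_nonneg _ _ _ _)
  have h1 := integral_mono hi ((hgi.indicator hA).add (hT.integrable_comp_of_integrable hi)) hpt
  have h2 : ∫ w, runningMax T g η N (T w) ∂P = ∫ w, runningMax T g η N w ∂P :=
    integral_comp_of_measurePreserving hT hi.aestronglyMeasurable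
  have h3 := integral_add (hgi.indicator hA) (hT.integrable_comp_of_integrable hi)
  simp only [Function.comp_apply] at h3
  have h5 : ∫ w, runningMax T g η N w ∂P ≤
      ∫ w, (A.indicator (fun w => g w - η) w + runningMax T g η N (T w)) ∂P := h1
  rw [h3, h2, integral_indicator hA, integral_sub hg.integrableOn (integrable_const η).integrableOn,
    setIntegral_const, smul_eq_mul] at h5
  have h4 : ∫ w in A, g w ∂P ≤ ∫ w, g w ∂P :=
    setIntegral_le_integral hg (Eventually.of_forall h0)
  linarith

/-- The maximal ergodic inequality. -/
theorem mul_measure_exists_birkhoffSum_gt_le [IsFiniteMeasure P] (hT : MeasurePreserving T P P)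
    {g : Ω → ℝ} (hgm : Measurable g) (hg : Integrable g P) (h0 : ∀ w, 0 ≤ g w) {η : ℝ}
    (hη : 0 < η) :
    P {w | ∃ n : ℕ, n * η < birkhoffSum T g n w} ≤ ENNReal.ofReal ((∫ w, g w ∂P) / η) := by
  have hsub : {w | ∃ n : ℕ, n * η < birkhoffSum T g n w} ⊆
      ⋃ N, {w | 0 < runningMax T g η N w} := by
    rintro w ⟨n, hn⟩
    have := birkhoffSum_le_runningMax (T := T) g η n w le_rfl
    exact Set.mem_iUnion.2 ⟨n, show 0 < runningMax T g η n w by linarith⟩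
  have hmono : Monotone fun N => {w | 0 < runningMax T g η N w} :=
    monotone_nat_of_le_succ fun N w hw => lt_of_lt_of_le hw (runningMax_le_succ g η N w)
  refine (measure_mono hsub).trans ?_
  rw [hmono.measure_iUnion]
  refine iSup_le fun N => ?_
  rw [← ofReal_measureReal]
  refine ENNReal.ofReal_le_ofReal ?_
  rw [le_div_iff₀ hη, mul_comm]
  exact mul_measure_runningMax_pos_le hT hgm hg h0 η N

theorem integrable_birkhoffSum (hT : MeasurePreserving T P P) {g : Ω → ℝ} (hg : Integrable g P)
    (n : ℕ) : Integrable (birkhoffSum T g n) P :=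
  integrable_finsetSum _ fun k _ => (hT.iterate k).integrable_comp_of_integrable hg

theorem integral_birkhoffSum (hT : MeasurePreserving T P P) {g : Ω → ℝ} (hg : Integrable g P)
    (n : ℕ) : ∫ w, birkhoffSum T g n w ∂P = n * ∫ w, g w ∂P := by
  unfold birkhoffSum
  rw [integral_finsetSum (f := fun k w => g (T^[k] w)) _
    fun k _ => (hT.iterate k).integrable_comp_of_integrable hg]
  rw [Finset.sum_congr rfl fun k _ =>
    integral_comp_of_measurePreserving (hT.iterate k) hg.aestronglyMeasurable]
  simp

theorem integrable_of_subadditive (hT : MeasurePreserving T P P) (hf : ∀ n, Measurable (f n))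
    (hf0 : ∀ w, f 0 w = 0) (hpos : ∀ n w, 0 ≤ f n w)
    (hsub : ∀ n m w, f (n + m) w ≤ f n w + f m (T^[n] w)) (hint : Integrable (f 1) P) (n : ℕ) :
    Integrable (f n) P := by
  refine (integrable_birkhoffSum hT hint n).mono' (hf n).aestronglyMeasurable
    (Eventually.of_forall fun w => ?_)
  rw [Real.norm_of_nonneg (hpos n w)]
  exact le_birkhoffSum hf0 hsub n w

/-- Fatou's lemma gives the lower limit L a finite integral. Since L ≤ L ∘ T and both have the same
integral, they agree almost everywhere, and ergodicity makes L constant. -/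
theorem exists_ae_liminf_eq [IsProbabilityMeasure P] (hT : Ergodic T P)
    (hf : ∀ n, Measurable (f n)) (hf0 : ∀ w, f 0 w = 0) (hpos : ∀ n w, 0 ≤ f n w)
    (hsub : ∀ n m w, f (n + m) w ≤ f n w + f m (T^[n] w)) (hint : Integrable (f 1) P) :
    ∃ c : ℝ, 0 ≤ c ∧
      ∀ᵐ w ∂P, liminf (fun n : ℕ => ENNReal.ofReal (f n w / n)) atTop = ENNReal.ofReal c := by
  have hTm := hT.toMeasurePreserving
  set L : Ω → ℝ≥0∞ := fun w => liminf (fun n : ℕ => ENNReal.ofReal (f n w / n)) atTop with hL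
  have hF : ∀ n : ℕ, Measurable fun w => ENNReal.ofReal (f n w / n) := fun n =>
    ((hf n).div_const _).ennreal_ofReal
  have hLm : Measurable L := Measurable.liminf hF
  have hLint : ∫⁻ w, L w ∂P ≤ ENNReal.ofReal (∫ w, f 1 w ∂P) := by
    refine (lintegral_liminf_le hF).trans ?_
    refine (liminf_le_liminf (v := fun _ => ENNReal.ofReal (∫ w, f 1 w ∂P))
      (Eventually.of_forall fun n => ?_)).trans (liminf_const _).le
    rw [← ofReal_integral_eq_lintegral_ofReal
      ((integrable_of_subadditive hTm hf hf0 hpos hsub hint n).div_const _)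
      (Eventually.of_forall fun w => div_nonneg (hpos n w) n.cast_nonneg), integral_div]
    refine ENNReal.ofReal_le_ofReal ?_
    rcases Nat.eq_zero_or_pos n with rfl | hn
    · simpa using integral_nonneg (hpos 1)
    · have hn' : (0 : ℝ) < n := by exact_mod_cast hn
      rw [div_le_iff₀ hn', mul_comm, ← integral_birkhoffSum hTm hint n]
      exact integral_mono (integrable_of_subadditive hTm hf hf0 hpos hsub hint n)
        (integrable_birkhoffSum hTm hint n) (le_birkhoffSum hf0 hsub n)
  have hLtop : ∫⁻ w, L w ∂P ≠ ∞ := (lt_of_le_of_lt hLint ENNReal.ofReal_lt_top).ne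
  have hcomp : L =ᵐ[P] L ∘ T := by
    refine ae_eq_of_ae_le_of_lintegral_le
      (Eventually.of_forall fun w => liminf_le_liminf_comp hpos hsub w) hLtop
      (hLm.comp hTm.measurable).aemeasurable ?_
    exact (hTm.lintegral_comp hLm).le
  obtain ⟨c, hc⟩ := hT.ae_eq_const_of_ae_eq_comp₀ hLm.nullMeasurable hcomp.symm
  have hctop : c ≠ ∞ := by
    rintro rfl
    rw [lintegral_congr_ae hc] at hLtop
    simp at hLtop
  refine ⟨c.toReal, ENNReal.toReal_nonneg, hc.mono fun w hw => ?_⟩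
  rw [ENNReal.ofReal_toReal hctop]
  exact hw

/-- The exceptional sets decrease with `N`, to a null set by `hex`. Domination by `f 1` makes its
integral over them tend to 0. -/
theorem exists_badSet [IsProbabilityMeasure P] (hf : ∀ n, Measurable (f n))
    (hpos : ∀ n w, 0 ≤ f n w) (hint : Integrable (f 1) P) {c : ℝ}
    (hex : ∀ᵐ w ∂P, ∃ j : ℕ, 1 ≤ j ∧ f j w ≤ j * c) {δ : ℝ} (hδ : 0 < δ) :
    ∃ (N : ℕ) (D : Set Ω), MeasurableSet D ∧ ∫ w, D.indicator (f 1) w ∂P < δ ∧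
      ∀ w, w ∉ D → f 1 w ≤ N ∧ ∃ j : ℕ, 1 ≤ j ∧ j ≤ N ∧ f j w ≤ j * c := by
  let D : ℕ → Set Ω := fun N => {w | f 1 w ≤ N ∧ ∃ j : ℕ, 1 ≤ j ∧ j ≤ N ∧ f j w ≤ j * c}ᶜ
  have hD : ∀ N, MeasurableSet (D N) := by
    intro N
    refine MeasurableSet.compl ((measurableSet_le (hf 1) measurable_const).inter ?_)
    have : {w | ∃ j : ℕ, 1 ≤ j ∧ j ≤ N ∧ f j w ≤ j * c} =
        ⋃ j : ℕ, ⋃ (_ : 1 ≤ j ∧ j ≤ N), {w | f j w ≤ j * c} := by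
      ext w
      simp [and_assoc]
    change MeasurableSet {w | ∃ j : ℕ, 1 ≤ j ∧ j ≤ N ∧ f j w ≤ j * c}
    rw [this]
    exact MeasurableSet.iUnion fun j => MeasurableSet.iUnion fun _ =>
      measurableSet_le (hf j) measurable_const
  have hlim : Tendsto (fun N => ∫ w, (D N).indicator (f 1) w ∂P) atTop (𝓝 (∫ _, (0 : ℝ) ∂P)) := by
    refine tendsto_integral_of_dominated_convergence (f 1)
      (fun N => ((hf 1).indicator (hD N)).aestronglyMeasurable) hint (fun N =>
        Eventually.of_forall fun w => ?_) (hex.mono fun w hw => ?_)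
    · rw [Real.norm_of_nonneg (Set.indicator_nonneg (fun w _ => hpos 1 w) _)]
      exact Set.indicator_le_self' (fun w _ => hpos 1 w) w
    · obtain ⟨j, hj, hjw⟩ := hw
      obtain ⟨K, hK⟩ := exists_nat_ge (f 1 w)
      refine tendsto_const_nhds.congr' ?_
      filter_upwards [eventually_ge_atTop (max j K)] with N hN
      rw [Set.indicator_of_notMem]
      refine fun hmem => hmem ⟨hK.trans ?_, j, hj, le_of_max_le_left hN, hjw⟩
      exact_mod_cast le_of_max_le_right hN
  rw [integral_zero] at hlim
  obtain ⟨N, hN⟩ := (hlim.eventually_lt_const hδ).exists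
  exact ⟨N, D N, hD N, hN, fun w hw => not_not.1 hw⟩

/-- **Subadditive ergodic theorem** for an ergodic transformation and a nonnegative sequence. -/
theorem exists_tendsto [IsProbabilityMeasure P] (hT : Ergodic T P)
    (hf : ∀ n, Measurable (f n)) (hf0 : ∀ w, f 0 w = 0) (hpos : ∀ n w, 0 ≤ f n w)
    (hsub : ∀ n m w, f (n + m) w ≤ f n w + f m (T^[n] w)) (hint : Integrable (f 1) P) :
    ∃ c : ℝ, 0 ≤ c ∧ (∀ᵐ w ∂P, Tendsto (fun n : ℕ => f n w / n) atTop (𝓝 c)) ∧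
      Tendsto (fun n : ℕ => ∫ w, |f n w / n - c| ∂P) atTop (𝓝 0) := by
  have hTm := hT.toMeasurePreserving
  have hfi := integrable_of_subadditive hTm hf hf0 hpos hsub hint
  obtain ⟨c, hc0, hc⟩ := exists_ae_liminf_eq hT hf hf0 hpos hsub hint
  have hlow : ∀ᵐ w ∂P, ∀ a < c, ∀ᶠ n : ℕ in atTop, a < f n w / n := by
    filter_upwards [hc] with w hw a ha
    rcases lt_or_ge a 0 with h | h
    · exact Eventually.of_forall fun n => h.trans_le (div_nonneg (hpos n w) n.cast_nonneg)
    · have h1 : ENNReal.ofReal a < liminf (fun n : ℕ => ENNReal.ofReal (f n w / n)) atTop := by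
        rw [hw]
        exact (ENNReal.ofReal_lt_ofReal_iff (h.trans_lt ha)).2 ha
      filter_upwards [eventually_lt_of_lt_liminf h1] with n hn
      exact (ENNReal.ofReal_lt_ofReal_iff_of_nonneg h).1 hn
  have hex : ∀ c' > c, ∀ᵐ w ∂P, ∃ j : ℕ, 1 ≤ j ∧ f j w ≤ j * c' := by
    intro c' hc'
    filter_upwards [hc] with w hw
    have h1 : liminf (fun n : ℕ => ENNReal.ofReal (f n w / n)) atTop < ENNReal.ofReal c' := by
      rw [hw]
      exact (ENNReal.ofReal_lt_ofReal_iff (hc0.trans_lt hc')).2 hc'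
    obtain ⟨j, hj, hj1⟩ := ((frequently_lt_of_liminf_lt (by isBoundedDefault) h1).and_eventually
      (eventually_ge_atTop 1)).exists
    have hj' : (0 : ℝ) < j := by exact_mod_cast hj1
    refine ⟨j, hj1, ?_⟩
    have := (ENNReal.ofReal_lt_ofReal_iff (hc0.trans_lt hc')).1 hj
    rw [div_lt_iff₀ hj'] at this
    linarith
  have hbound : ∀ c' > c, ∀ δ > 0, ∃ (N : ℕ) (H : Ω → ℝ), Measurable H ∧ Integrable H P ∧
      (∀ w, 0 ≤ H w) ∧ ∫ w, H w ∂P < δ ∧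
      ∀ n w, f n w ≤ n * c' + birkhoffSum T H n w + N * N := by
    intro c' hc' δ hδ
    obtain ⟨N, D, hD, hDδ, hDN⟩ := exists_badSet hf hpos hint (hex c' hc') hδ
    refine ⟨N, D.indicator (f 1), (hf 1).indicator hD, hint.indicator hD,
      fun w => Set.indicator_nonneg (fun w _ => hpos 1 w) _, hDδ, fun n w => ?_⟩
    refine (le_of_covering hf0 hpos hsub (hc0.trans hc'.le) hDN n w).trans ?_
    gcongr
    exact min_le_right _ _
  -- The bad event does not involve ε: choosing ∫ H < εη, the maximal inequality bounds its measure
  -- by ε. One η pays for the Birkhoff averages of H, the other for N²/n.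
  have hup : ∀ c' > c, ∀ η > 0, ∀ᵐ w ∂P, ∀ᶠ n : ℕ in atTop, f n w / n ≤ c' + 2 * η := by
    intro c' hc' η hη
    rw [ae_iff]
    refine le_antisymm (ENNReal.le_of_forall_pos_le_add fun ε hε _ => ?_) bot_le
    obtain ⟨N, H, hHm, hHi, hH0, hHδ, hHN⟩ := hbound c' hc' (ε * η) (mul_pos hε hη)
    rw [zero_add]
    refine (measure_mono ?_).trans ((mul_measure_exists_birkhoffSum_gt_le hTm hHm hHi hH0 hη).trans
      ?_)
    · intro w hw
      by_contra hcon
      refine hw ?_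
      simp only [Set.mem_ofPred_eq, not_exists, not_lt] at hcon
      have hlarge := (tendsto_natCast_atTop_atTop (R := ℝ) |>.atTop_mul_const hη)
        |>.eventually_ge_atTop ((N : ℝ) * N)
      filter_upwards [hlarge, eventually_ge_atTop 1] with n hn hn1
      have hn' : (0 : ℝ) < n := by exact_mod_cast hn1
      rw [div_le_iff₀ hn']
      linarith [hHN n w, hcon n]
    · refine (ENNReal.ofReal_le_ofReal ((div_le_iff₀ hη).2 hHδ.le)).trans ?_
      simp
  have hae : ∀ᵐ w ∂P, Tendsto (fun n : ℕ => f n w / n) atTop (𝓝 c) := by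
    have hup' : ∀ᵐ w ∂P, ∀ k : ℕ, ∀ᶠ n : ℕ in atTop,
        f n w / n ≤ c + 1 / ((k : ℝ) + 1) + 2 * (1 / ((k : ℝ) + 1)) :=
      ae_all_iff.2 fun k => hup _ (by
        have := Nat.one_div_pos_of_nat (α := ℝ) (n := k)
        linarith) _ Nat.one_div_pos_of_nat
    filter_upwards [hlow, hup'] with w h1 h2
    refine tendsto_order.2 ⟨h1, fun b hb => ?_⟩
    obtain ⟨k, hk⟩ := exists_nat_one_div_lt (show 0 < (b - c) / 3 by linarith)
    filter_upwards [h2 k] with n hn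
    linarith
  refine ⟨c, hc0, hae, ?_⟩
  -- Nonnegativity of `f` bounds the negative part of f n / n - c by c, so this half of the L¹
  -- convergence is dominated convergence.
  have hneg : Tendsto (fun n : ℕ => ∫ w, max (c - f n w / n) 0 ∂P) atTop (𝓝 (∫ _, (0 : ℝ) ∂P)) := by
    refine tendsto_integral_of_dominated_convergence (fun _ => c)
      (fun n => ((measurable_const.sub ((hf n).div_const _)).max
        measurable_const).aestronglyMeasurable) (integrable_const c)
      (fun n => Eventually.of_forall fun w => ?_) (hae.mono fun w hw => ?_)
    · rw [Real.norm_of_nonneg (le_max_right _ _)]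
      exact max_le (by linarith [div_nonneg (hpos n w) (Nat.cast_nonneg (α := ℝ) n)]) hc0
    · have := (tendsto_const_nhds (x := c)).sub hw |>.max (tendsto_const_nhds (x := (0 : ℝ)))
      simpa using this
  rw [integral_zero] at hneg
  have hdi : ∀ n : ℕ, Integrable (fun w => f n w / n) P := fun n => (hfi n).div_const _
  have hmi : ∀ n : ℕ, Integrable (fun w => max (c - f n w / n) 0) P := fun n =>
    ((integrable_const c).sub (hdi n)).sup (integrable_zero _ _ _)
  -- From |t| = t + 2 t⁻: beyond `hneg`, only an upper bound on the mean of f n / n is needed.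
  have habs : ∀ n : ℕ, ∫ w, |f n w / n - c| ∂P =
      (∫ w, f n w ∂P) / n - c + 2 * ∫ w, max (c - f n w / n) 0 ∂P := by
    intro n
    rw [← integral_div, ← integral_const_mul]
    have h1 : ∫ w, (f n w / n - c) ∂P = ∫ w, f n w / n ∂P - c := by
      rw [integral_sub (hdi n) (integrable_const c)]
      simp
    rw [← h1, ← integral_add (f := fun w => f n w / n - c)
      ((hdi n).sub (integrable_const c)) ((hmi n).const_mul 2)]
    refine integral_congr_ae (Eventually.of_forall fun w => ?_)
    simp only
    rcases le_total (f n w / n) c with h | h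
    · rw [max_eq_left (by linarith), abs_of_nonpos (by linarith)]
      ring
    · rw [max_eq_right (by linarith), abs_of_nonneg (by linarith)]
      ring
  refine tendsto_order.2 ⟨fun a ha => Eventually.of_forall fun n =>
    ha.trans_le (integral_nonneg fun w => abs_nonneg _), fun b hb => ?_⟩
  -- Error budget: b/8 each from the slope, from ∫ H and from N²/n, and 2b/8 from the doubled
  -- negative part; in all 5b/8 < b.
  obtain ⟨N, H, hHm, hHi, hH0, hHδ, hHN⟩ := hbound (c + b / 8) (by linarith) (b / 8) (by linarith)
  have hlarge := (tendsto_natCast_atTop_atTop (R := ℝ) |>.atTop_mul_const (show 0 < b / 8 by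
    linarith)) |>.eventually_ge_atTop ((N : ℝ) * N)
  filter_upwards [hlarge, eventually_ge_atTop 1,
    hneg.eventually_lt_const (show 0 < b / 8 by linarith)] with n hn hn1 hn2
  have hn' : (0 : ℝ) < n := by exact_mod_cast hn1
  have h1 : ∫ w, f n w ∂P ≤ n * (c + b / 8) + n * ∫ w, H w ∂P + N * N := by
    have hi1 : Integrable (fun w => n * (c + b / 8) + birkhoffSum T H n w) P :=
      (integrable_const _).add (integrable_birkhoffSum hTm hHi n)
    refine (integral_mono (hfi n) (hi1.add (integrable_const _)) (hHN n)).trans_eq ?_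
    simp only [Pi.add_apply]
    rw [integral_add hi1 (integrable_const _), integral_add (integrable_const _)
      (integrable_birkhoffSum hTm hHi n), integral_birkhoffSum hTm hHi]
    simp
  rw [habs]
  have h2 : (∫ w, f n w ∂P) / n ≤ c + 3 * (b / 8) := by
    rw [div_le_iff₀ hn']
    nlinarith
  linarith

end SubadditiveErgodic

/-! ### Finite partitions and densities -/

namespace StatGraph

theorem continuous_phi : Continuous phi := Real.continuous_mul_log

theorem convexOn_phi : ConvexOn ℝ (Set.Ici 0) phi := Real.convexOn_mul_log

theorem phi_one : phi 1 = 0 := by simp [phi]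

variable {Ω : Type*} {S m0 : MeasurableSpace Ω} {π ν : Measure Ω} {g : Ω → ℝ} {R : ℝ}

/-- On the σ-algebra `S`, the function `g` is a bounded density of `ν` with respect to `π`. -/
structure IsBddDensity (S : MeasurableSpace Ω) {m0 : MeasurableSpace Ω} (ν π : Measure Ω)
    (R : ℝ) (g : Ω → ℝ) : Prop where
  measurable : Measurable[S] g
  nonneg : ∀ w, 0 ≤ g w
  le : ∀ w, g w ≤ R
  measure_eq : ∀ A, MeasurableSet[S] A → ν A = ∫⁻ w in A, ENNReal.ofReal (g w) ∂π

namespace IsBddDensity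

theorem integrable (h : IsBddDensity S ν π R g) (hS : S ≤ m0) [IsFiniteMeasure π] :
    Integrable g π :=
  Integrable.of_bound (h.measurable.mono hS le_rfl).aestronglyMeasurable R
    (Eventually.of_forall fun w => by
      rw [Real.norm_of_nonneg (h.nonneg w)]
      exact h.le w)

theorem integrable_phi (h : IsBddDensity S ν π R g) (hS : S ≤ m0) [IsFiniteMeasure π] :
    Integrable (fun w => phi (g w)) π := by
  obtain ⟨C, hC⟩ := (isCompact_Icc (a := (0 : ℝ)) (b := R)).exists_bound_of_continuousOn
    continuous_phi.continuousOn
  exact Integrable.of_bound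
    (continuous_phi.measurable.comp (h.measurable.mono hS le_rfl)).aestronglyMeasurable C
    (Eventually.of_forall fun w => hC _ ⟨h.nonneg w, h.le w⟩)

theorem measureReal_eq (h : IsBddDensity S ν π R g) (hS : S ≤ m0) [IsFiniteMeasure π] {A : Set Ω}
    (hA : MeasurableSet[S] A) : ν.real A = ∫ w in A, g w ∂π := by
  rw [Measure.real, h.measure_eq A hA, integral_eq_lintegral_of_nonneg_ae
    (Eventually.of_forall h.nonneg) (h.integrable hS).aestronglyMeasurable.restrict]

/-- The density relation holds only on `S`, so both measures are trimmed to `S`; this is why `F`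
must be `S`-measurable. -/
theorem integral_eq (h : IsBddDensity S ν π R g) (hS : S ≤ m0) {F : Ω → ℝ}
    (hF : Measurable[S] F) : ∫ w, F w ∂ν = ∫ w, g w * F w ∂π := by
  have htrim : ν.trim hS = (π.withDensity fun w => ENNReal.ofReal (g w)).trim hS := by
    refine @Measure.ext _ S _ _ fun A hA => ?_
    rw [trim_measurableSet_eq hS hA, trim_measurableSet_eq hS hA, withDensity_apply _ (hS A hA),
      h.measure_eq A hA]
  have hF' : StronglyMeasurable[S] F := hF.stronglyMeasurable
  rw [integral_trim hS hF', htrim, ← integral_trim hS hF',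
    integral_withDensity_eq_integral_toReal_smul (h.measurable.mono hS le_rfl).ennreal_ofReal
      (Eventually.of_forall fun _ => ENNReal.ofReal_lt_top)]
  refine integral_congr_ae (Eventually.of_forall fun w => ?_)
  simp [ENNReal.toReal_ofReal (h.nonneg w)]

/-- Jensen's inequality on the cell: ν(A)/π(A) is the average of the density over A. -/
theorem phi_mul_le (h : IsBddDensity S ν π R g) (hS : S ≤ m0) [IsFiniteMeasure π] {A : Set Ω}
    (hA : MeasurableSet[S] A) :
    phi (ν.real A / π.real A) * π.real A ≤ ∫ w in A, phi (g w) ∂π := by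
  rcases eq_or_ne (π A) 0 with h0 | h0
  · rw [Measure.restrict_eq_zero.2 h0]
    simp [Measure.real, h0]
  have hpos : 0 < π.real A := ENNReal.toReal_pos h0 (measure_ne_top _ _)
  have hJ := convexOn_phi.map_set_average_le continuous_phi.continuousOn isClosed_Ici h0
    (measure_ne_top _ _) (Eventually.of_forall fun w => h.nonneg w) (h.integrable hS).integrableOn
    (h.integrable_phi hS).integrableOn
  rw [setAverage_eq, setAverage_eq, ← h.measureReal_eq hS hA, smul_eq_mul, smul_eq_mul,
    inv_mul_eq_div, inv_mul_eq_div] at hJ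
  exact (le_div_iff₀ hpos).1 hJ

theorem sum_le (h : IsBddDensity S ν π R g) (hS : S ≤ m0) [IsFiniteMeasure π] {k : ℕ}
    {A : Fin k → Set Ω} (hA : IsFinPartition S A) :
    ∑ i, phi (ν.real (A i) / π.real (A i)) * π.real (A i) ≤ ∫ w, phi (g w) ∂π := by
  rw [← setIntegral_univ, ← hA.cover, integral_iUnion_fintype (fun i => hS _ (hA.measurable i))
    hA.disjoint fun i => (h.integrable_phi hS).integrableOn]
  exact Finset.sum_le_sum fun i _ => h.phi_mul_le hS (hA.measurable i)

/-- Cut along level sets of the density with mesh 1/(N+1), below the modulus of uniform continuity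
of `phi` on [0, R]. -/
theorem exists_partition (h : IsBddDensity S ν π R g) (hS : S ≤ m0) [IsProbabilityMeasure π]
    {ε : ℝ} (hε : 0 < ε) :
    ∃ (k : ℕ) (A : Fin k → Set Ω), IsFinPartition S A ∧
      ∫ w, phi (g w) ∂π ≤ ∑ i, phi (ν.real (A i) / π.real (A i)) * π.real (A i) + ε := by
  obtain ⟨δ, hδ, hφ⟩ := Metric.uniformContinuousOn_iff.1
    ((isCompact_Icc (a := (0 : ℝ)) (b := R)).uniformContinuousOn_of_continuous
      continuous_phi.continuousOn) ε hε
  obtain ⟨N, hN⟩ := exists_nat_one_div_lt hδ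
  have hN0 : (0 : ℝ) < (N : ℝ) + 1 := by positivity
  let A : Fin (⌊R * (N + 1)⌋₊ + 1) → Set Ω := fun i => {w | ⌊g w * (N + 1)⌋₊ = i}
  have hpart : IsFinPartition S A := by
    refine ⟨fun i => ?_, fun i j hij => ?_, ?_⟩
    · exact (Nat.measurable_floor.comp (h.measurable.mul_const _)) (measurableSet_singleton (i : ℕ))
    · refine Set.disjoint_left.2 fun w hi hj => hij (Fin.ext ?_)
      exact (show _ = (i : ℕ) from hi).symm.trans hj
    · refine Set.eq_univ_of_forall fun w => Set.mem_iUnion.2 ⟨⟨⌊g w * (N + 1)⌋₊, ?_⟩, rfl⟩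
      exact Nat.lt_succ_of_le (Nat.floor_mono (mul_le_mul_of_nonneg_right (h.le w) hN0.le))
  refine ⟨_, A, hpart, ?_⟩
  have hcell : ∀ i, ∫ w in A i, phi (g w) ∂π ≤
      phi (ν.real (A i) / π.real (A i)) * π.real (A i) + ε * π.real (A i) := by
    intro i
    have hAi := hS _ (hpart.measurable i)
    rcases eq_or_ne (π (A i)) 0 with h0 | h0
    · rw [Measure.restrict_eq_zero.2 h0]
      simp [Measure.real, h0]
    have hpos : 0 < π.real (A i) := ENNReal.toReal_pos h0 (measure_ne_top _ _)
    -- As the average of `g` over the cell, `s` lies in the same level interval as every value of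
    -- `g` there.
    set s := ν.real (A i) / π.real (A i) with hs
    have hmem : ∀ w ∈ A i, (i : ℝ) / (N + 1) ≤ g w ∧ g w ≤ ((i : ℝ) + 1) / (N + 1) := by
      intro w hw
      have hw' : ⌊g w * (N + 1)⌋₊ = i := hw
      have h1 := Nat.floor_le (mul_nonneg (h.nonneg w) hN0.le)
      have h2 := Nat.lt_floor_add_one (g w * (N + 1))
      rw [hw'] at h1 h2
      exact ⟨(div_le_iff₀ hN0).2 h1, (le_div_iff₀ hN0).2 h2.le⟩
    have hconst : ∀ a : ℝ, ∫ _ in A i, a ∂π = a * π.real (A i) := fun a => by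
      rw [setIntegral_const, smul_eq_mul, mul_comm]
    have hlow : ∀ a : ℝ, (∀ w ∈ A i, a ≤ g w) → a ≤ s := by
      intro a ha
      rw [hs, le_div_iff₀ hpos, h.measureReal_eq hS (hpart.measurable i), ← hconst]
      exact setIntegral_mono_on (integrable_const a).integrableOn (h.integrable hS).integrableOn
        hAi ha
    have hup : ∀ a : ℝ, (∀ w ∈ A i, g w ≤ a) → s ≤ a := by
      intro a ha
      rw [hs, div_le_iff₀ hpos, h.measureReal_eq hS (hpart.measurable i), ← hconst]
      exact setIntegral_mono_on (h.integrable hS).integrableOn (integrable_const a).integrableOn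
        hAi ha
    have hsR : s ∈ Set.Icc 0 R := ⟨hlow 0 fun w _ => h.nonneg w, hup R fun w _ => h.le w⟩
    have hs1 := hlow _ fun w hw => (hmem w hw).1
    have hs2 := hup _ fun w hw => (hmem w hw).2
    rw [add_div] at hs2
    have hpt : ∀ w ∈ A i, phi (g w) ≤ phi s + ε := by
      intro w hw
      obtain ⟨h1, h2⟩ := hmem w hw
      rw [add_div] at h2
      have := hφ (g w) ⟨h.nonneg w, h.le w⟩ s hsR (by
        rw [Real.dist_eq, abs_lt]
        constructor <;> linarith)
      rw [Real.dist_eq, abs_lt] at this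
      linarith [this.2]
    refine (setIntegral_mono_on (h.integrable_phi hS).integrableOn
      (integrable_const _).integrableOn hAi hpt).trans_eq ?_
    rw [hconst, add_mul]
  rw [← setIntegral_univ, ← hpart.cover, integral_iUnion_fintype
    (fun i => hS _ (hpart.measurable i)) hpart.disjoint fun i => (h.integrable_phi hS).integrableOn]
  refine (Finset.sum_le_sum fun i _ => hcell i).trans_eq ?_
  rw [Finset.sum_add_distrib, ← Finset.mul_sum]
  congr 1
  have : ∑ i, π.real (A i) = 1 := by
    rw [← measureReal_iUnion_fintype hpart.disjoint fun i => hS _ (hpart.measurable i), hpart.cover,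
      probReal_univ]
  rw [this, mul_one]

theorem integral_phi_nonneg (h : IsBddDensity S ν π R g) (hS : S ≤ m0) [IsProbabilityMeasure π]
    [IsProbabilityMeasure ν] : 0 ≤ ∫ w, phi (g w) ∂π := by
  have := h.phi_mul_le hS (@MeasurableSet.univ _ S)
  simpa [phi_one] using this

end IsBddDensity

/-- Jensen bounds every partition sum by the integral, and fine level-set partitions come within any
ε of it. -/
theorem mutualInfo_eq {Ω : Type*} {m₁ m₂ : MeasurableSpace Ω} [m0 : MeasurableSpace Ω]
    (h₁ : m₁ ≤ m0) (h₂ : m₂ ≤ m0) (P : Measure Ω) [IsProbabilityMeasure P] {R : ℝ}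
    {g : Ω × Ω → ℝ} (h : IsBddDensity (m₁.comap Prod.fst ⊔ m₂.comap Prod.snd)
      (P.map fun ω => (ω, ω)) (P.prod P) R g) :
    mutualInfo m₁ m₂ P = ENNReal.ofReal (∫ w, phi (g w) ∂(P.prod P)) := by
  have hS : m₁.comap Prod.fst ⊔ m₂.comap Prod.snd ≤ (inferInstance : MeasurableSpace (Ω × Ω)) :=
    sup_le_sup (MeasurableSpace.comap_mono h₁) (MeasurableSpace.comap_mono h₂)
  refine le_antisymm ?_ ?_
  · exact iSup_le fun k => iSup_le fun A => iSup_le fun hA =>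
      ENNReal.ofReal_le_ofReal (h.sum_le hS hA)
  · refine ENNReal.le_of_forall_pos_le_add fun ε hε _ => ?_
    obtain ⟨k, A, hA, hle⟩ := h.exists_partition hS (show (0 : ℝ) < ε from hε)
    refine (ENNReal.ofReal_le_ofReal hle).trans (ENNReal.ofReal_add_le.trans ?_)
    rw [ENNReal.ofReal_coe_nnreal]
    gcongr
    exact le_iSup_of_le k (le_iSup_of_le A (le_iSup_of_le hA le_rfl))

/-- In a Hilbert space, reverse martingales converge. -/
theorem cauchySeq_of_inner_eq {H : Type*} [NormedAddCommGroup H] [InnerProductSpace ℝ H]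
    {X : ℕ → H} (hX : ∀ n k, n ≤ k → inner ℝ (X n) (X k) = inner ℝ (X k) (X k)) :
    CauchySeq X := by
  -- `hX` says that X n - X k is orthogonal to X k; this is Pythagoras.
  have hdist : ∀ n k, n ≤ k → ‖X n - X k‖ ^ 2 = ‖X n‖ ^ 2 - ‖X k‖ ^ 2 := by
    intro n k hnk
    rw [norm_sub_sq_real, hX n k hnk, real_inner_self_eq_norm_sq]
    ring
  have hanti : Antitone fun n => ‖X n‖ ^ 2 := fun n k hnk => by
    have := hdist n k hnk
    have h2 : 0 ≤ ‖X n - X k‖ ^ 2 := by positivity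
    simp only
    linarith
  have hconv := tendsto_atTop_ciInf hanti ⟨0, by rintro _ ⟨n, rfl⟩; positivity⟩
  rw [Metric.cauchySeq_iff']
  intro ε hε
  obtain ⟨N, hN⟩ := Metric.cauchySeq_iff'.1 hconv.cauchySeq (ε ^ 2) (by positivity)
  refine ⟨N, fun n hn => ?_⟩
  have h1 := hN n hn
  rw [Real.dist_eq, abs_sub_comm, ← hdist N n hn, abs_of_nonneg (by positivity)] at h1
  rw [dist_comm, dist_eq_norm]
  exact lt_of_pow_lt_pow_left₀ 2 hε.le h1

/-- The densities on a decreasing sequence of σ-algebras converge almost everywhere along a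
subsequence. -/
theorem exists_subseq_tendsto_density [IsFiniteMeasure π] {S : ℕ → MeasurableSpace Ω}
    (hS : ∀ n, S n ≤ m0) (hanti : Antitone S) {g : ℕ → Ω → ℝ}
    (hg : ∀ n, IsBddDensity (S n) ν π R (g n)) :
    ∃ ns : ℕ → ℕ, StrictMono ns ∧
      ∀ᵐ w ∂π, ∃ l, Tendsto (fun k => g (ns k) w) atTop (𝓝 l) := by
  have hmem : ∀ n, MemLp (g n) 2 π := fun n =>
    MemLp.of_bound ((hg n).measurable.mono (hS n) le_rfl).aestronglyMeasurable R
      (Eventually.of_forall fun w => by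
        rw [Real.norm_of_nonneg ((hg n).nonneg w)]
        exact (hg n).le w)
  have hinner : ∀ n k, inner ℝ ((hmem n).toLp (g n)) ((hmem k).toLp (g k)) =
      ∫ w, g n w * g k w ∂π := by
    intro n k
    rw [L2.inner_def]
    refine integral_congr_ae ?_
    filter_upwards [(hmem n).coeFn_toLp, (hmem k).coeFn_toLp] with w h1 h2
    rw [h1, h2]
    simp [mul_comm]
  -- For n ≤ k, `g k` is measurable for both σ-algebras, so ∫ g n · g k dπ and ∫ g k · g k dπ are
  -- both ∫ g k dν.
  have hC : CauchySeq fun n => (hmem n).toLp (g n) := by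
    refine cauchySeq_of_inner_eq fun n k hnk => ?_
    rw [hinner, hinner, ← (hg k).integral_eq (hS k) (hg k).measurable,
      ← (hg n).integral_eq (hS n) ((hg k).measurable.mono (hanti hnk) le_rfl)]
  obtain ⟨l, hl⟩ := cauchySeq_tendsto_of_complete hC
  obtain ⟨ns, hns, hae⟩ := (tendstoInMeasure_of_tendsto_Lp hl).exists_seq_tendsto_ae
  refine ⟨ns, hns, ?_⟩
  have hall : ∀ᵐ w ∂π, ∀ n, (hmem n).toLp (g n) w = g n w :=
    ae_all_iff.2 fun n => (hmem n).coeFn_toLp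
  filter_upwards [hae, hall] with w h1 h2
  exact ⟨l w, by simpa only [h2] using h1⟩

end StatGraph

namespace StatGraph

/-! ### The simple random walk on a fixed graph -/

namespace LFGraph

variable (G : LFGraph)

instance : DiscreteMeasurableSpace G.V := ⟨fun _ => trivial⟩

theorem mem_nbrs {x y : G.V} : y ∈ G.nbrs x ↔ G.mult x y ≠ 0 := by simp [nbrs]

theorem dist_le_succ_of_mult_ne_zero (x : G.V) {y z : G.V} (h : G.mult y z ≠ 0) :
    G.simple.dist x z ≤ G.simple.dist x y + 1 := by
  by_cases hyz : y = z
  · subst hyz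
    exact Nat.le_succ _
  · have hadj : G.simple.Adj y z := ⟨hyz, h⟩
    have := G.connected.dist_triangle (u := x) (v := y) (w := z)
    rwa [SimpleGraph.dist_eq_one_iff_adj.2 hadj] at this

/-- The witness is the penultimate vertex of a geodesic. It drives the inductions on radius, for
finiteness of balls and for restricting ball isomorphisms. -/
theorem exists_mult_ne_zero_of_dist_le_succ {x y : G.V} {n : ℕ} (h : G.simple.dist x y ≤ n + 1) :
    G.simple.dist x y ≤ n ∨ ∃ z, G.simple.dist x z ≤ n ∧ G.mult z y ≠ 0 := by
  obtain ⟨p, hp⟩ := G.connected.exists_walk_length_eq_dist x y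
  by_cases hnil : p.Nil
  · left
    rw [← hp, SimpleGraph.Walk.length_eq_zero_iff.2 hnil]
    exact Nat.zero_le _
  · right
    refine ⟨p.penultimate, ?_, (p.adj_penultimate hnil).2⟩
    refine (SimpleGraph.dist_le p.dropLast).trans ?_
    have : p.dropLast.length + 1 = p.length := p.length_dropLast_add_one hnil
    omega

theorem finite_setOf_dist_le (x : G.V) (n : ℕ) : {y | G.simple.dist x y ≤ n}.Finite := by
  induction n with
  | zero =>
    refine (Set.finite_singleton x).subset fun y hy => ?_
    exact (G.connected.dist_eq_zero_iff.1 (Nat.le_zero.1 hy)).symm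
  | succ n ih =>
    refine (ih.union (ih.biUnion fun z _ => G.finite_nbrs z)).subset fun y hy => ?_
    rcases G.exists_mult_ne_zero_of_dist_le_succ hy with h | ⟨z, hz, hzy⟩
    · exact Or.inl h
    · exact Or.inr (Set.mem_biUnion hz hzy)

instance : Countable G.V := by
  obtain ⟨x⟩ := G.connected.nonempty
  rw [← Set.countable_univ_iff]
  have : (Set.univ : Set G.V) = ⋃ n, {y | G.simple.dist x y ≤ n} :=
    (Set.eq_univ_of_forall fun y => Set.mem_iUnion.2 ⟨_, le_refl (G.simple.dist x y)⟩).symm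
  rw [this]
  exact Set.countable_iUnion fun n => (G.finite_setOf_dist_le x n).countable

theorem p_nonneg (x y : G.V) : 0 ≤ G.p x y := by
  unfold p
  positivity

theorem p_pos {x y : G.V} (h : G.mult x y ≠ 0) : 0 < G.p x y :=
  div_pos (by exact_mod_cast Nat.pos_of_ne_zero h) (by exact_mod_cast G.deg_pos x)

theorem pn_nonneg (n : ℕ) (x y : G.V) : 0 ≤ G.pn n x y := by
  induction n generalizing x with
  | zero =>
    rw [pn]
    split_ifs <;> norm_num
  | succ n ih => exact Finset.sum_nonneg fun z _ => mul_nonneg (G.p_nonneg _ _) (ih z)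

theorem mul_pn_le_pn_succ (n : ℕ) (x y z : G.V) : G.p x z * G.pn n z y ≤ G.pn (n + 1) x y := by
  by_cases hz : z ∈ G.nbrs x
  · exact Finset.single_le_sum (f := fun z => G.p x z * G.pn n z y)
      (fun z _ => mul_nonneg (G.p_nonneg _ _) (G.pn_nonneg n z y)) hz
  · have : G.mult x z = 0 := by simpa [mem_nbrs] using hz
    simp only [p, this]
    simpa using G.pn_nonneg (n + 1) x y

theorem pn_mul_pn_le (n m : ℕ) (x y z : G.V) : G.pn n x y * G.pn m y z ≤ G.pn (n + m) x z := by
  induction n generalizing x with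
  | zero =>
    rw [pn, zero_add]
    split_ifs with h
    · rw [h, one_mul]
    · rw [zero_mul]
      exact G.pn_nonneg _ _ _
  | succ n ih =>
    rw [Nat.add_right_comm, pn, pn, Finset.sum_mul]
    refine Finset.sum_le_sum fun w _ => ?_
    rw [mul_assoc]
    exact mul_le_mul_of_nonneg_left (ih w) (G.p_nonneg _ _)

theorem pn_pos_of_path {ω : ℕ → G.V} (h : ∀ n, G.mult (ω n) (ω (n + 1)) ≠ 0) (m k : ℕ) :
    0 < G.pn k (ω m) (ω (m + k)) := by
  induction k generalizing m with
  | zero => simp [pn]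
  | succ k ih =>
    have h1 := ih (m + 1)
    rw [show m + 1 + k = m + (k + 1) by omega] at h1
    exact lt_of_lt_of_le (mul_pos (G.p_pos (h m)) h1) (G.mul_pn_le_pn_succ k _ _ _)

theorem finite_support_pn (n : ℕ) (x : G.V) : {y | G.pn n x y ≠ 0}.Finite := by
  induction n generalizing x with
  | zero =>
    refine (Set.finite_singleton x).subset fun y hy => ?_
    by_contra hne
    exact hy (by rw [pn, if_neg (Ne.symm hne)])
  | succ n ih =>
    refine ((G.nbrs x).finite_toSet.biUnion fun z _ => ih z).subset fun y hy => ?_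
    obtain ⟨z, hz, hzy⟩ := Finset.exists_ne_zero_of_sum_ne_zero hy
    exact Set.mem_biUnion hz (right_ne_zero_of_mul hzy)

/-! ### Cylinders and their probabilities. -/

/-- The first `n + 1` terms of a sequence. -/
abbrev init (n : ℕ) (ω : ℕ → G.V) : (i : Finset.Iic n) → G.V :=
  Preorder.frestrictLe (π := fun _ => G.V) n ω

theorem measurable_init (n : ℕ) : Measurable (G.init n) :=
  Preorder.measurable_frestrictLe (X := fun _ => G.V) n

theorem measurableSet_coord (n : ℕ) (y : G.V) : MeasurableSet {ω : ℕ → G.V | ω n = y} :=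
  measurable_pi_apply (X := fun _ => G.V) n (measurableSet_singleton y)

/-- The sequences which start with `a 0, …, a n`. -/
def cyl (n : ℕ) (a : ℕ → G.V) : Set (ℕ → G.V) := {ω | ∀ i ≤ n, ω i = a i}

variable {G}

theorem cyl_eq_preimage (n : ℕ) (a : ℕ → G.V) :
    G.cyl n a = G.init n ⁻¹' {G.init n a} := by
  ext ω
  constructor
  · exact fun h => funext fun i => h i (Finset.mem_Iic.1 i.2)
  · exact fun h i hi => congrFun h ⟨i, Finset.mem_Iic.2 hi⟩

theorem measurableSet_cyl (n : ℕ) (a : ℕ → G.V) : MeasurableSet (G.cyl n a) := by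
  rw [cyl_eq_preimage]
  exact G.measurable_init n (measurableSet_singleton _)

theorem exists_frestrictLe_eq (n : ℕ) (b : (i : Finset.Iic n) → G.V) :
    ∃ a : ℕ → G.V, G.init n a = b := by
  classical
  obtain ⟨x⟩ := G.connected.nonempty
  refine ⟨fun i => if h : i ∈ Finset.Iic n then b ⟨i, h⟩ else x, funext fun i => ?_⟩
  simp only [Preorder.frestrictLe_apply]
  rw [dif_pos i.2]

theorem map_frestrictLe_ext {n : ℕ} {μ ν : Measure (ℕ → G.V)}
    (h : ∀ a, μ (G.cyl n a) = ν (G.cyl n a)) :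
    μ.map (G.init n) = ν.map (G.init n) := by
  refine Measure.ext_of_singleton fun b => ?_
  obtain ⟨a, rfl⟩ := exists_frestrictLe_eq n b
  rw [Measure.map_apply (G.measurable_init n) (measurableSet_singleton _),
    Measure.map_apply (G.measurable_init n) (measurableSet_singleton _),
    ← cyl_eq_preimage]
  exact h a

/-- Vertices are countable, so cylinder masses determine the finite-dimensional marginals, and a
projective limit of finite measures is unique. -/
theorem measure_ext_of_cyl {μ ν : Measure (ℕ → G.V)} [IsFiniteMeasure ν]
    (h : ∀ n a, μ (G.cyl n a) = ν (G.cyl n a)) : μ = ν := by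
  have hP : IsProjectiveMeasureFamily (α := fun _ => G.V) fun J : Finset ℕ =>
      ν.map (Finset.restrict (π := fun _ => G.V) J) := by
    intro I J hJI
    rw [Measure.map_map (Finset.measurable_restrict₂ hJI) (Finset.measurable_restrict I)]
    rfl
  have hν : IsProjectiveLimit (α := fun _ => G.V) ν fun J : Finset ℕ =>
      ν.map (Finset.restrict (π := fun _ => G.V) J) :=
    fun _ => rfl
  refine IsProjectiveLimit.unique (α := fun _ => G.V)
    (P := fun J : Finset ℕ => ν.map (Finset.restrict (π := fun _ => G.V) J))
    ((isProjectiveLimit_nat_iff hP μ).2 fun n => ?_) hν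
  exact map_frestrictLe_ext (h n)

variable (G)

instance (x : G.V) : IsProbabilityMeasure (G.walkFrom x) := by
  unfold walkFrom
  infer_instance

theorem stepPMF_toMeasure_singleton (x y : G.V) :
    (G.stepPMF x).toMeasure {y} = ENNReal.ofReal (G.p x y) := by
  rw [PMF.toMeasure_apply_singleton _ _ (measurableSet_singleton _)]
  rfl

theorem walkFrom_cyl_succ (x : G.V) (n : ℕ) (a : ℕ → G.V) :
    G.walkFrom x (G.cyl (n + 1) a) =
      G.walkFrom x (G.cyl n a) * ENNReal.ofReal (G.p (a n) (a (n + 1))) := by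
  have h := Kernel.partialTraj_compProd_eq_map_traj (X := fun _ => G.V) (κ := G.stepKernel)
    (Nat.zero_le n) (x₀ := fun _ => x)
  have hset : G.cyl (n + 1) a = (fun ω : ℕ → G.V => (G.init n ω, ω (n + 1))) ⁻¹'
      ({G.init n a} ×ˢ {a (n + 1)}) := by
    ext ω
    rw [Set.mem_preimage, Set.mem_prod]
    change _ ↔ ω ∈ G.init n ⁻¹' {G.init n a} ∧ _
    rw [← cyl_eq_preimage]
    constructor
    · exact fun hω => ⟨fun i hi => hω i (hi.trans n.le_succ), hω _ le_rfl⟩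
    · rintro ⟨h1, h2⟩ i hi
      rcases Nat.le_succ_iff.1 hi with h | rfl
      · exact h1 i h
      · exact h2
  have hm : Measurable fun ω : ℕ → G.V => (G.init n ω, ω (n + 1)) :=
    (G.measurable_init n).prodMk (measurable_pi_apply _)
  rw [hset, walkFrom, ← Measure.map_apply hm
    ((measurableSet_singleton _).prod (measurableSet_singleton _)), ← h,
    Measure.compProd_apply_prod (measurableSet_singleton _) (measurableSet_singleton _),
    lintegral_singleton, ← Kernel.traj_map_frestrictLe_apply,
    Measure.map_apply (G.measurable_init n) (measurableSet_singleton _),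
    ← cyl_eq_preimage, mul_comm]
  congr 1
  exact G.stepPMF_toMeasure_singleton _ _

open Classical in
theorem walkFrom_cyl_zero (x : G.V) (a : ℕ → G.V) :
    G.walkFrom x (G.cyl 0 a) = if a 0 = x then 1 else 0 := by
  rw [cyl_eq_preimage, walkFrom, ← Measure.map_apply (G.measurable_init 0)
    (measurableSet_singleton _)]
  unfold init
  rw [Kernel.traj_map_frestrictLe_apply, Kernel.partialTraj_self,
    Kernel.id_apply, Measure.dirac_apply' _ (measurableSet_singleton _)]
  split_ifs with h
  · rw [Set.indicator_of_mem]
    · rfl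
    · refine funext fun i => ?_
      have : (i : ℕ) = 0 := Nat.le_zero.1 (Finset.mem_Iic.1 i.2)
      rw [Preorder.frestrictLe_apply, this, h]
  · rw [Set.indicator_of_notMem]
    intro hmem
    have := congrFun hmem ⟨0, Finset.mem_Iic.2 le_rfl⟩
    exact h this.symm

open Classical in
/-- The probability that the walk starts with `a 0, …, a n`. -/
theorem walkFrom_cyl (x : G.V) (n : ℕ) (a : ℕ → G.V) :
    G.walkFrom x (G.cyl n a) = (if a 0 = x then 1 else 0) *
      ∏ i ∈ Finset.range n, ENNReal.ofReal (G.p (a i) (a (i + 1))) := by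
  induction n with
  | zero => simpa using G.walkFrom_cyl_zero x a
  | succ n ih => rw [walkFrom_cyl_succ, ih, Finset.prod_range_succ, mul_assoc]

/-- The shift on sequences. -/
def drop (m : ℕ) (ω : ℕ → G.V) : ℕ → G.V := fun i => ω (m + i)

theorem measurable_drop (m : ℕ) : Measurable (G.drop m) :=
  measurable_pi_lambda _ fun _ => measurable_pi_apply _

/-- If `a` starts where `b` ends, the intersection is the cylinder of the concatenation `c` and the
product formula splits at `m`. Otherwise both sides vanish. -/
theorem walkFrom_cyl_inter_drop_cyl (x : G.V) (m n : ℕ) (b a : ℕ → G.V) :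
    G.walkFrom x (G.cyl m b ∩ G.drop m ⁻¹' G.cyl n a) =
      G.walkFrom x (G.cyl m b) * G.walkFrom (b m) (G.cyl n a) := by
  by_cases h : a 0 = b m
  · let c : ℕ → G.V := fun i => if i ≤ m then b i else a (i - m)
    have hc1 : ∀ i ≤ m, c i = b i := fun i hi => if_pos hi
    have hc2 : ∀ i, c (m + i) = a i := by
      intro i
      rcases Nat.eq_zero_or_pos i with rfl | hi
      · rw [add_zero, hc1 m le_rfl, h]
      · simp only [c]
        rw [if_neg (by omega), Nat.add_sub_cancel_left]
    have hset : G.cyl m b ∩ G.drop m ⁻¹' G.cyl n a = G.cyl (m + n) c := by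
      ext ω
      constructor
      · rintro ⟨h1, h2⟩ i hi
        rcases le_total i m with him | him
        · rw [hc1 i him, h1 i him]
        · obtain ⟨j, rfl⟩ := Nat.exists_eq_add_of_le him
          rw [hc2]
          exact h2 j (by omega)
      · intro hω
        refine ⟨fun i hi => by rw [hω i (by omega), hc1 i hi], fun i hi => ?_⟩
        have := hω (m + i) (by omega)
        rwa [hc2] at this
    rw [hset, walkFrom_cyl, walkFrom_cyl, walkFrom_cyl, Finset.prod_range_add, if_pos h,
      hc1 0 (Nat.zero_le _), one_mul, mul_assoc]
    congr 2
    · refine Finset.prod_congr rfl fun i hi => ?_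
      have := Finset.mem_range.1 hi
      rw [hc1 i (by omega), hc1 (i + 1) (by omega)]
    · refine Finset.prod_congr rfl fun i _ => ?_
      rw [hc2, add_assoc, hc2]
  · have hset : G.cyl m b ∩ G.drop m ⁻¹' G.cyl n a = ∅ := by
      refine Set.eq_empty_of_forall_notMem fun ω hω => h ?_
      rw [← hω.1 m le_rfl, ← hω.2 0 (Nat.zero_le _)]
      rfl
    rw [hset, walkFrom_cyl _ (b m), if_neg h]
    simp

theorem walkFrom_cyl_inter_drop (x : G.V) (m : ℕ) (b : ℕ → G.V) {D : Set (ℕ → G.V)}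
    (hD : MeasurableSet D) :
    G.walkFrom x (G.cyl m b ∩ G.drop m ⁻¹' D) =
      G.walkFrom x (G.cyl m b) * G.walkFrom (b m) D := by
  have h : ((G.walkFrom x).restrict (G.cyl m b)).map (G.drop m) =
      G.walkFrom x (G.cyl m b) • G.walkFrom (b m) := by
    have : IsFiniteMeasure (G.walkFrom x (G.cyl m b) • G.walkFrom (b m)) :=
      Measure.smul_finite _ (measure_ne_top _ _)
    refine measure_ext_of_cyl fun n a => ?_
    rw [Measure.map_apply (G.measurable_drop m) (measurableSet_cyl n a), Measure.restrict_apply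
      (G.measurable_drop m (measurableSet_cyl n a)), Set.inter_comm, walkFrom_cyl_inter_drop_cyl,
      Measure.smul_apply, smul_eq_mul]
  have := congrArg (fun μ => μ D) h
  simpa [Measure.map_apply (G.measurable_drop m) hD, Measure.restrict_apply
    (G.measurable_drop m hD), Set.inter_comm] using this

/-! ### Past and future σ-algebras, and the Markov property. -/

theorem past_eq_comap (m : ℕ) : G.past m =
    MeasurableSpace.comap (G.init m) MeasurableSpace.pi := by
  refine le_antisymm (iSup_le fun i => ?_) ?_
  · rintro _ ⟨s, hs, rfl⟩
    exact ⟨(fun b => b ⟨i.1, Finset.mem_Iic.2 i.2⟩) ⁻¹' s, measurable_pi_apply _ hs, rfl⟩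
  · rw [← measurable_iff_comap_le]
    refine @measurable_pi_lambda _ _ _ (G.past m) _ _ fun i => ?_
    have : MeasurableSpace.comap (fun ω : ℕ → G.V => ω i) ⊤ ≤ G.past m :=
      le_iSup (fun j : {j : ℕ // j ≤ m} => MeasurableSpace.comap (fun ω : ℕ → G.V => ω j.1) ⊤)
        ⟨i, Finset.mem_Iic.1 i.2⟩
    exact measurable_iff_comap_le.2 this

theorem future_eq_comap (n : ℕ) :
    G.future n = MeasurableSpace.comap (G.drop n) MeasurableSpace.pi := by
  refine le_antisymm (iSup_le fun i => ?_) ?_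
  · rintro _ ⟨s, hs, rfl⟩
    refine ⟨(fun ω => ω (i.1 - n)) ⁻¹' s, measurable_pi_apply _ hs, ?_⟩
    ext ω
    simp only [drop, Set.mem_preimage]
    rw [Nat.add_sub_cancel' i.2]
  · rw [← measurable_iff_comap_le]
    refine @measurable_pi_lambda _ _ _ (G.future n) _ _ fun i => ?_
    have : MeasurableSpace.comap (fun ω : ℕ → G.V => ω (n + i)) ⊤ ≤ G.future n :=
      le_iSup (fun j : {j : ℕ // n ≤ j} => MeasurableSpace.comap (fun ω : ℕ → G.V => ω j.1) ⊤)
        ⟨n + i, Nat.le_add_right _ _⟩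
    exact measurable_iff_comap_le.2 this

theorem past_le (m : ℕ) : G.past m ≤ MeasurableSpace.pi := by
  rw [past_eq_comap]
  exact (G.measurable_init m).comap_le

theorem future_le (n : ℕ) : G.future n ≤ MeasurableSpace.pi := by
  rw [future_eq_comap]
  exact (G.measurable_drop n).comap_le

theorem tail_le_future (n : ℕ) : G.tail ≤ G.future n := iInf_le _ n

theorem antitone_future : Antitone G.future := fun _ _ h =>
  iSup_le fun i => le_iSup_of_le ⟨i.1, h.trans i.2⟩ le_rfl

theorem measurable_coord_past {m i : ℕ} (h : i ≤ m) :
    Measurable[G.past m] fun ω : ℕ → G.V => ω i :=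
  measurable_iff_comap_le.2
    (le_iSup (fun j : {j : ℕ // j ≤ m} => MeasurableSpace.comap (fun ω : ℕ → G.V => ω j.1) ⊤)
      ⟨i, h⟩)

theorem measurable_coord_future {n i : ℕ} (h : n ≤ i) :
    Measurable[G.future n] fun ω : ℕ → G.V => ω i :=
  measurable_iff_comap_le.2
    (le_iSup (fun j : {j : ℕ // n ≤ j} => MeasurableSpace.comap (fun ω : ℕ → G.V => ω j.1) ⊤)
      ⟨i, h⟩)

/-- The Markov property. -/
theorem walkFrom_inter_drop (x : G.V) (m : ℕ) {B D : Set (ℕ → G.V)}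
    (hB : MeasurableSet[G.past m] B) (hD : MeasurableSet D) :
    G.walkFrom x (B ∩ G.drop m ⁻¹' D) = ∫⁻ ω in B, G.walkFrom (ω m) D ∂G.walkFrom x := by
  rw [past_eq_comap] at hB
  obtain ⟨B', hB', rfl⟩ := hB
  have hF : Measurable fun ω : ℕ → G.V => G.walkFrom (ω m) D :=
    (measurable_from_top (f := fun y : G.V => G.walkFrom y D)).comp (measurable_pi_apply m)
  have hr := G.measurable_init m
  -- As functions of the past event, both sides are measures on initial segments. It suffices to
  -- compare cylinders, on which `ω m` is constant.
  have h : ((G.walkFrom x).restrict (G.drop m ⁻¹' D)).map (G.init m) =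
      ((G.walkFrom x).withDensity fun ω => G.walkFrom (ω m) D).map (G.init m) := by
    refine map_frestrictLe_ext fun b => ?_
    rw [Measure.restrict_apply (measurableSet_cyl m b), walkFrom_cyl_inter_drop _ _ _ _ hD,
      withDensity_apply _ (measurableSet_cyl m b)]
    rw [setLIntegral_congr_fun (g := fun _ => G.walkFrom (b m) D) (measurableSet_cyl m b)
      fun ω hω => by simp only [hω m le_rfl], setLIntegral_const, mul_comm]
  have := congrArg (fun μ => μ B') h
  rwa [Measure.map_apply hr hB', Measure.map_apply hr hB', Measure.restrict_apply (hr hB'),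
    withDensity_apply _ (hr hB')] at this

theorem walkFrom_coord_zero (x : G.V) : ∀ᵐ ω ∂G.walkFrom x, ω 0 = x := by
  classical
  have h := G.walkFrom_cyl_zero x fun _ => x
  rw [if_pos rfl] at h
  have h2 : ∀ᵐ ω ∂G.walkFrom x, ω ∈ G.cyl 0 fun _ => x :=
    (mem_ae_iff_prob_eq_one (measurableSet_cyl _ _)).2 h
  exact h2.mono fun ω hω => hω 0 le_rfl

theorem walkFrom_coord_one (x y : G.V) :
    G.walkFrom x {ω | ω 1 = y} = ENNReal.ofReal (G.p x y) := by
  classical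
  let a : ℕ → G.V := fun i => if i = 0 then x else y
  have h := G.walkFrom_cyl x 1 a
  simp only [a, if_true, Finset.prod_range_one, one_mul, if_neg one_ne_zero, zero_add] at h
  rw [← h]
  refine measure_congr ?_
  filter_upwards [G.walkFrom_coord_zero x] with ω hω
  refine propext ⟨fun h1 i hi => ?_, fun h1 => h1 1 le_rfl⟩
  interval_cases i
  · exact hω
  · exact h1

/-- Conditioning on the first step reproduces the recursion defining `pn`. -/
theorem walkFrom_coord (n : ℕ) (x y : G.V) :
    G.walkFrom x {ω | ω n = y} = ENNReal.ofReal (G.pn n x y) := by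
  classical
  induction n generalizing x with
  | zero =>
    have h := G.walkFrom_coord_zero x
    rw [pn]
    split_ifs with hxy
    · rw [ENNReal.ofReal_one, ← hxy]
      exact (mem_ae_iff_prob_eq_one (G.measurableSet_coord 0 x)).1 h
    · rw [ENNReal.ofReal_zero]
      refine measure_mono_null (fun ω hω => ?_) h
      exact fun h0 => hxy (h0.symm.trans hω)
  | succ n ih =>
    have hD := G.measurableSet_coord n y
    have hM := G.walkFrom_inter_drop x 1 (@MeasurableSet.univ _ (G.past 1)) hD
    rw [Set.univ_inter, Measure.restrict_univ] at hM
    have hset : G.drop 1 ⁻¹' {ω | ω n = y} = {ω | ω (n + 1) = y} := by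
      ext ω
      simp [drop, add_comm]
    rw [hset] at hM
    simp only [ih] at hM
    rw [hM, ← lintegral_map (f := fun z => ENNReal.ofReal (G.pn n z y)) measurable_from_top
      (measurable_pi_apply 1), lintegral_countable']
    have hs : ∀ z, (G.walkFrom x).map (fun ω => ω 1) {z} = ENNReal.ofReal (G.p x z) := fun z => by
      rw [Measure.map_apply (measurable_pi_apply 1) (measurableSet_singleton z)]
      exact G.walkFrom_coord_one x z
    simp only [hs]
    rw [tsum_eq_sum (s := G.nbrs x) fun z hz => by rw [G.p_eq_zero x z hz, mul_zero], pn,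
      ENNReal.ofReal_sum_of_nonneg fun z _ => mul_nonneg (G.p_nonneg _ _) (G.pn_nonneg _ _ _)]
    refine Finset.sum_congr rfl fun z _ => ?_
    rw [ENNReal.ofReal_mul (G.p_nonneg _ _), mul_comm]

theorem pn_le_one (n : ℕ) (x y : G.V) : G.pn n x y ≤ 1 := by
  have := prob_le_one (μ := G.walkFrom x) (s := {ω | ω n = y})
  rwa [walkFrom_coord, ENNReal.ofReal_le_one] at this

theorem walkFrom_coord_inter_drop (x z : G.V) (n : ℕ) {D : Set (ℕ → G.V)} (hD : MeasurableSet D) :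
    G.walkFrom x ({ω | ω n = z} ∩ G.drop n ⁻¹' D) =
      ENNReal.ofReal (G.pn n x z) * G.walkFrom z D := by
  have hB : MeasurableSet[G.past n] {ω : ℕ → G.V | ω n = z} :=
    G.measurable_coord_past le_rfl (measurableSet_singleton z)
  rw [G.walkFrom_inter_drop x n hB hD,
    setLIntegral_congr_fun (g := fun _ => G.walkFrom z D) (G.past_le n _ hB)
      fun ω hω => by simp only [show ω n = z from hω], setLIntegral_const, walkFrom_coord, mul_comm]

theorem setLIntegral_drop (x : G.V) (n : ℕ) {D : Set (ℕ → G.V)} (hD : MeasurableSet D)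
    (F : G.V → ℝ≥0∞) :
    ∫⁻ ω in G.drop n ⁻¹' D, F (ω n) ∂G.walkFrom x =
      ∑' z, F z * (ENNReal.ofReal (G.pn n x z) * G.walkFrom z D) := by
  rw [← lintegral_map (f := F) measurable_from_top (measurable_pi_apply n), lintegral_countable']
  refine tsum_congr fun z => ?_
  rw [Measure.map_apply (measurable_pi_apply n) (measurableSet_singleton z),
    Measure.restrict_apply (measurable_pi_apply n (measurableSet_singleton z)),
    ← G.walkFrom_coord_inter_drop x z n hD]
  rfl

theorem walkFrom_drop (x : G.V) (n : ℕ) {D : Set (ℕ → G.V)} (hD : MeasurableSet D) :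
    G.walkFrom x (G.drop n ⁻¹' D) = ∑' z, ENNReal.ofReal (G.pn n x z) * G.walkFrom z D := by
  have := G.setLIntegral_drop x n hD fun _ => 1
  simpa using this

theorem ae_pn_ne_zero (n : ℕ) (x : G.V) : ∀ᵐ ω ∂G.walkFrom x, G.pn n x (ω n) ≠ 0 := by
  have hset : {ω : ℕ → G.V | ¬ G.pn n x (ω n) ≠ 0} = ⋃ y ∈ {y | G.pn n x y = 0}, {ω | ω n = y} := by
    ext ω
    simp
  rw [ae_iff, hset, measure_biUnion_null_iff (Set.to_countable _)]
  intro y hy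
  rw [walkFrom_coord, show G.pn n x y = 0 from hy, ENNReal.ofReal_zero]

theorem ae_path (x : G.V) :
    ∀ᵐ ω ∂G.walkFrom x, ω 0 = x ∧ ∀ n, G.mult (ω n) (ω (n + 1)) ≠ 0 := by
  refine (G.walkFrom_coord_zero x).and (ae_all_iff.2 fun n => ?_)
  have hD : MeasurableSet {ω : ℕ → G.V | G.mult (ω 0) (ω 1) = 0} := by
    have h1 : Measurable fun ω : ℕ → G.V => (ω 0, ω 1) :=
      (measurable_pi_apply 0).prodMk (measurable_pi_apply 1)
    exact h1 (DiscreteMeasurableSpace.forall_measurableSet {q : G.V × G.V | G.mult q.1 q.2 = 0})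
  have hnull : ∀ z, G.walkFrom z {ω : ℕ → G.V | G.mult (ω 0) (ω 1) = 0} = 0 := by
    intro z
    have hset : {ω : ℕ → G.V | G.mult z (ω 1) = 0} = ⋃ y ∈ {y | G.mult z y = 0}, {ω | ω 1 = y} := by
      ext ω
      simp
    have h0 : G.walkFrom z {ω : ℕ → G.V | G.mult z (ω 1) = 0} = 0 := by
      rw [hset, measure_biUnion_null_iff (Set.to_countable _)]
      intro y hy
      rw [walkFrom_coord_one, p, show G.mult z y = 0 from hy]
      simp
    rw [← h0]
    refine measure_congr ?_
    filter_upwards [G.walkFrom_coord_zero z] with ω hω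
    refine propext (show G.mult (ω 0) (ω 1) = 0 ↔ G.mult z (ω 1) = 0 from ?_)
    rw [hω]
  have h := G.walkFrom_drop x n hD
  simp only [hnull, mul_zero, tsum_zero] at h
  rw [ae_iff]
  convert h using 2
  ext ω
  simp [drop]

end LFGraph

end StatGraph

namespace StatGraph

/-! ### Mutual information along the simple random walk -/

namespace LFGraph

variable (G : LFGraph) (x : G.V) (m k : ℕ)

/-- The pairs of events of the past up to time `m` and of the σ-algebra `F`. -/
abbrev pastProd (m : ℕ) (F : MeasurableSpace (ℕ → G.V)) :
    MeasurableSpace ((ℕ → G.V) × (ℕ → G.V)) :=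
  (G.past m).comap Prod.fst ⊔ F.comap Prod.snd

theorem pastProd_le {F : MeasurableSpace (ℕ → G.V)} (hF : F ≤ MeasurableSpace.pi) :
    G.pastProd m F ≤ @Prod.instMeasurableSpace _ _ MeasurableSpace.pi MeasurableSpace.pi :=
  sup_le_sup (MeasurableSpace.comap_mono (G.past_le m)) (MeasurableSpace.comap_mono hF)

/-- The first path enters only through the countable-valued `w.1 m`, so joint measurability reduces
to that of each section. This keeps the limit density measurable for past × tail. -/
theorem measurable_pastProd (F : MeasurableSpace (ℕ → G.V)) {f : G.V → (ℕ → G.V) → ℝ}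
    (hf : ∀ y, Measurable[F] (f y)) :
    Measurable[G.pastProd m F] fun w : (ℕ → G.V) × (ℕ → G.V) => f (w.1 m) w.2 := by
  have h1 : Measurable[G.pastProd m F] fun w : (ℕ → G.V) × (ℕ → G.V) => w.1 m :=
    (G.measurable_coord_past le_rfl).comp (measurable_iff_comap_le.2 le_sup_left)
  have h2 : Measurable[G.pastProd m F, F] fun w : (ℕ → G.V) × (ℕ → G.V) => w.2 :=
    measurable_iff_comap_le.2 le_sup_right
  have h3 : Measurable[@Prod.instMeasurableSpace _ _ ⊤ F] fun q : G.V × (ℕ → G.V) => f q.1 q.2 :=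
    @measurable_from_prod_countable_right _ _ _ ⊤ F _ _ ⟨fun _ => trivial⟩
      (fun q : G.V × (ℕ → G.V) => f q.1 q.2) hf
  exact h3.comp (@Measurable.prodMk _ (G.pastProd m F) _ _ ⊤ F _ _ h1 h2)

/-- The density, on events of the past up to time `m` and of the future from time `m + k` on, of
the law of two identical walks with respect to that of two independent walks. -/
noncomputable def infoDensity (w : (ℕ → G.V) × (ℕ → G.V)) : ℝ :=
  open Classical in
  -- The value 0 at vertices that cannot be occupied at time `m` makes the bound by the largest
  -- 1/p^m(x, y) hold everywhere, not only almost everywhere.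
  if G.pn m x (w.1 m) = 0 then 0
  else G.pn k (w.1 m) (w.2 (m + k)) / G.pn (m + k) x (w.2 (m + k))

theorem exists_inv_pn_le : ∃ R : ℝ, 0 ≤ R ∧ ∀ y, G.pn m x y ≠ 0 → (G.pn m x y)⁻¹ ≤ R := by
  refine ⟨∑ y ∈ (G.finite_support_pn m x).toFinset, (G.pn m x y)⁻¹,
    Finset.sum_nonneg fun y _ => inv_nonneg.2 (G.pn_nonneg _ _ _), fun y hy => ?_⟩
  exact Finset.single_le_sum (f := fun y => (G.pn m x y)⁻¹)
    (fun y _ => inv_nonneg.2 (G.pn_nonneg _ _ _)) (by simpa using hy)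

theorem infoDensity_nonneg (w) : 0 ≤ G.infoDensity x m k w := by
  unfold infoDensity
  split_ifs
  · exact le_rfl
  · exact div_nonneg (G.pn_nonneg _ _ _) (G.pn_nonneg _ _ _)

theorem infoDensity_le {R : ℝ} (hR : 0 ≤ R) (h : ∀ y, G.pn m x y ≠ 0 → (G.pn m x y)⁻¹ ≤ R) (w) :
    G.infoDensity x m k w ≤ R := by
  unfold infoDensity
  split_ifs with h0
  · exact hR
  · refine le_trans ?_ (h _ h0)
    have hpos : 0 < G.pn m x (w.1 m) := (G.pn_nonneg _ _ _).lt_of_ne' h0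
    rcases (G.pn_nonneg (m + k) x (w.2 (m + k))).eq_or_lt' with h1 | h1
    · rw [h1, div_zero]
      exact inv_nonneg.2 hpos.le
    · rw [div_le_iff₀ h1, inv_mul_eq_div, le_div_iff₀ hpos, mul_comm]
      exact G.pn_mul_pn_le _ _ _ _ _

theorem measurable_infoDensity :
    Measurable[G.pastProd m (G.future (m + k))] (G.infoDensity x m k) := by
  classical
  refine G.measurable_pastProd m (G.future (m + k))
    (f := fun y ω => if G.pn m x y = 0 then 0 else
      G.pn k y (ω (m + k)) / G.pn (m + k) x (ω (m + k)))
    fun y => ?_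
  exact (measurable_from_top (f := fun z : G.V =>
    if G.pn m x y = 0 then 0 else G.pn k y z / G.pn (m + k) x z)).comp
      (G.measurable_coord_future le_rfl)

/-- Integrating over the second path first, the denominator cancels its law at time m + k and leaves
the probability that the walk from `ω m` has its future in `D`. The Markov property at time `m`
concludes. -/
theorem measure_prod_of_past_future {B C : Set (ℕ → G.V)} (hB : MeasurableSet[G.past m] B)
    (hC : MeasurableSet[G.future (m + k)] C) :
    G.walkFrom x (B ∩ C) = ∫⁻ w in B ×ˢ C, ENNReal.ofReal (G.infoDensity x m k w)
      ∂((G.walkFrom x).prod (G.walkFrom x)) := by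
  have hmeas : Measurable fun w => ENNReal.ofReal (G.infoDensity x m k w) :=
    ((G.measurable_infoDensity x m k).mono (G.pastProd_le m (G.future_le _))
      le_rfl).ennreal_ofReal
  rw [← Measure.prod_restrict, lintegral_prod _ hmeas.aemeasurable]
  rw [future_eq_comap] at hC
  obtain ⟨D, hD, rfl⟩ := hC
  have hset : G.drop (m + k) ⁻¹' D = G.drop m ⁻¹' (G.drop k ⁻¹' D) := by
    ext ω
    have : G.drop (m + k) ω = G.drop k (G.drop m ω) := funext fun i => congrArg ω (add_assoc m k i)
    rw [Set.mem_preimage, this]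
    rfl
  rw [hset, G.walkFrom_inter_drop x m hB (G.measurable_drop k hD), ← hset]
  refine lintegral_congr_ae (ae_restrict_of_ae ?_)
  filter_upwards [G.ae_pn_ne_zero m x] with ω hω
  have hpos : 0 < G.pn m x (ω m) := (G.pn_nonneg _ _ _).lt_of_ne' hω
  rw [walkFrom_drop _ _ _ hD]
  simp only [infoDensity, if_neg hω]
  rw [G.setLIntegral_drop x (m + k) hD
    fun z => ENNReal.ofReal (G.pn k (ω m) z / G.pn (m + k) x z)]
  refine tsum_congr fun z => ?_
  rw [← mul_assoc, ← ENNReal.ofReal_mul (div_nonneg (G.pn_nonneg _ _ _) (G.pn_nonneg _ _ _))]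
  -- If the denominator vanishes, so does the numerator, because p^m(x, ω m) > 0.
  rcases (G.pn_nonneg (m + k) x z).eq_or_lt' with h1 | h1
  · have h2 := G.pn_mul_pn_le m k x (ω m) z
    rw [h1] at h2 ⊢
    have h3 : G.pn k (ω m) z = 0 :=
      le_antisymm (nonpos_of_mul_nonpos_right h2 hpos) (G.pn_nonneg _ _ _)
    simp [h3]
  · rw [div_mul_cancel₀ _ h1.ne']

theorem isProbabilityMeasure_map_diag :
    IsProbabilityMeasure ((G.walkFrom x).map fun ω => (ω, ω)) :=
  Measure.isProbabilityMeasure_map (measurable_id.prodMk measurable_id).aemeasurable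

theorem isBddDensity_infoDensity {R : ℝ} (hR : 0 ≤ R)
    (h : ∀ y, G.pn m x y ≠ 0 → (G.pn m x y)⁻¹ ≤ R) :
    IsBddDensity (G.pastProd m (G.future (m + k))) ((G.walkFrom x).map fun ω => (ω, ω))
      ((G.walkFrom x).prod (G.walkFrom x)) R (G.infoDensity x m k) := by
  refine ⟨G.measurable_infoDensity x m k, G.infoDensity_nonneg x m k,
    G.infoDensity_le x m k hR h, ?_⟩
  have hS := G.pastProd_le m (G.future_le (m + k))
  have := G.isProbabilityMeasure_map_diag x
  let C : Set (Set ((ℕ → G.V) × (ℕ → G.V))) :=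
    Set.image2 (· ×ˢ ·) {s | MeasurableSet[G.past m] s} {t | MeasurableSet[G.future (m + k)] t}
  have hgen : G.pastProd m (G.future (m + k)) = MeasurableSpace.generateFrom C :=
    (@generateFrom_prod _ _ (G.past m) (G.future (m + k))).symm
  have hpi : IsPiSystem C := @isPiSystem_prod _ _ (G.past m) (G.future (m + k))
  have hrect : ∀ s ∈ C, ((G.walkFrom x).map fun ω => (ω, ω)) s =
      ((G.walkFrom x).prod (G.walkFrom x)).withDensity
        (fun w => ENNReal.ofReal (G.infoDensity x m k w)) s := by
    rintro _ ⟨B, hB, D, hD, rfl⟩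
    have hB' := G.past_le m _ hB
    have hD' := G.future_le _ _ hD
    have hdiag : Measurable fun ω : ℕ → G.V => (ω, ω) := measurable_id.prodMk measurable_id
    rw [withDensity_apply _ (hB'.prod hD'), Measure.map_apply hdiag (hB'.prod hD'),
      ← G.measure_prod_of_past_future x m k hB hD]
    rfl
  have htrim : ((G.walkFrom x).map fun ω => (ω, ω)).trim hS =
      (((G.walkFrom x).prod (G.walkFrom x)).withDensity
        (fun w => ENNReal.ofReal (G.infoDensity x m k w))).trim hS := by
    have := isFiniteMeasure_trim hS (μ := (G.walkFrom x).map fun ω => (ω, ω))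
    have hmC : ∀ s ∈ C, MeasurableSet[G.pastProd m (G.future (m + k))] s := fun s hs => by
      rw [hgen]
      exact MeasurableSpace.measurableSet_generateFrom hs
    have huniv : Set.univ ∈ C :=
      ⟨Set.univ, @MeasurableSet.univ _ (G.past m), Set.univ, @MeasurableSet.univ _ (G.future _),
        Set.univ_prod_univ⟩
    refine ext_of_generate_finite C hgen hpi (fun s hs => ?_) ?_
    · rw [trim_measurableSet_eq hS (hmC s hs), trim_measurableSet_eq hS (hmC s hs), hrect s hs]
    · rw [trim_measurableSet_eq hS (hmC _ huniv), trim_measurableSet_eq hS (hmC _ huniv),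
        hrect _ huniv]
  intro A hA
  rw [← withDensity_apply _ (hS _ hA), ← trim_measurableSet_eq hS hA, htrim,
    trim_measurableSet_eq hS hA]

/-- The mutual information of the past up to time `m` and of the future from time `m + k` on. -/
noncomputable def info : ℝ :=
  ∫ w, phi (G.infoDensity x m k w) ∂((G.walkFrom x).prod (G.walkFrom x))

theorem info_nonneg : 0 ≤ G.info x m k := by
  obtain ⟨R, hR, h⟩ := G.exists_inv_pn_le x m
  have := G.isProbabilityMeasure_map_diag x
  exact (G.isBddDensity_infoDensity x m k hR h).integral_phi_nonneg
    (G.pastProd_le m (G.future_le _))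

theorem ae_finite_coord : ∃ s : Finset G.V, ∀ᵐ ω ∂G.walkFrom x, ω m ∈ s :=
  ⟨(G.finite_support_pn m x).toFinset, (G.ae_pn_ne_zero m x).mono fun ω hω => by simpa using hω⟩

theorem integrable_coord (i j : ℕ) (F : G.V → G.V → ℝ) :
    Integrable (fun ω => F (ω i) (ω j)) (G.walkFrom x) := by
  obtain ⟨s, hs⟩ := G.ae_finite_coord x i
  obtain ⟨t, ht⟩ := G.ae_finite_coord x j
  have hij : Measurable fun ω : ℕ → G.V => (ω i, ω j) :=
    (measurable_pi_apply i).prodMk (measurable_pi_apply j)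
  have hm : Measurable fun ω : ℕ → G.V => F (ω i) (ω j) :=
    (measurable_of_countable fun q : G.V × G.V => F q.1 q.2).comp hij
  refine Integrable.of_bound hm.aestronglyMeasurable (∑ y ∈ s, ∑ z ∈ t, |F y z|) ?_
  filter_upwards [hs, ht] with ω h1 h2
  rw [Real.norm_eq_abs]
  refine le_trans ?_ (Finset.single_le_sum (f := fun y => ∑ z ∈ t, |F y z|)
    (fun y _ => Finset.sum_nonneg fun z _ => abs_nonneg _) h1)
  exact Finset.single_le_sum (f := fun z => |F (ω i) z|) (fun z _ => abs_nonneg _) h2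

/-- Since phi(g) = g log g, integrating it against the product law is integrating log g against the
diagonal law, where both paths coincide. -/
theorem info_eq : G.info x m k =
    ∫ ω, -Real.log (G.pn (m + k) x (ω (m + k))) ∂G.walkFrom x -
      ∫ ω, -Real.log (G.pn k (ω m) (ω (m + k))) ∂G.walkFrom x := by
  obtain ⟨R, hR, h⟩ := G.exists_inv_pn_le x m
  have hS := G.pastProd_le m (G.future_le (m + k))
  have hd := G.isBddDensity_infoDensity x m k hR h
  have hlog : Measurable[G.pastProd m (G.future (m + k))]
      fun w => Real.log (G.infoDensity x m k w) := Real.measurable_log.comp hd.measurable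
  have h1 : G.info x m k = ∫ w, Real.log (G.infoDensity x m k w)
      ∂(G.walkFrom x).map fun ω => (ω, ω) := (hd.integral_eq hS hlog).symm
  have hdiag : Measurable fun ω : ℕ → G.V => (ω, ω) := measurable_id.prodMk measurable_id
  rw [h1, integral_map hdiag.aemeasurable
    (hlog.mono hS le_rfl).aestronglyMeasurable, ← integral_sub
      (G.integrable_coord x 0 (m + k) fun _ z => -Real.log (G.pn (m + k) x z))
      (G.integrable_coord x m (m + k) fun y z => -Real.log (G.pn k y z))]
  refine integral_congr_ae ?_
  filter_upwards [G.ae_pn_ne_zero m x, G.ae_pn_ne_zero (m + k) x, G.ae_path x] with ω h2 h3 h4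
  have h5 := (G.pn_pos_of_path h4.2 m k).ne'
  simp only [infoDensity, if_neg h2]
  rw [Real.log_div h5 h3]
  ring

/-- Discarding the first N terms does not change a limsup, and the others depend on times at least
N. -/
theorem measurable_limsup_tail {ks : ℕ → ℕ} (hks : StrictMono ks) (F : ℕ → G.V → ℝ) :
    Measurable[G.tail] fun ω : ℕ → G.V => limsup (fun j => F j (ω (m + ks j))) atTop := by
  intro s hs
  refine MeasurableSpace.measurableSet_iInf.2 fun N => ?_
  have hshift : (fun ω : ℕ → G.V => limsup (fun j => F j (ω (m + ks j))) atTop) =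
      fun ω => limsup (fun j => F (j + N) (ω (m + ks (j + N)))) atTop := by
    funext ω
    exact (limsup_nat_add (fun j => F j (ω (m + ks j))) N).symm
  rw [hshift]
  refine @Measurable.limsup _ _ _ _ _ (G.future N) _ _ _ _ (fun j => ?_) s hs
  refine (measurable_from_top (f := F (j + N))).comp (G.measurable_coord_future ?_)
  have := hks.le_apply (x := j + N)
  omega

theorem antitone_pastProd_future : Antitone fun k => G.pastProd m (G.future (m + k)) :=
  fun _ _ h => sup_le_sup le_rfl
    (MeasurableSpace.comap_mono (G.antitone_future (Nat.add_le_add_left h m)))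

/-- Reverse martingale convergence gives an almost sure limit of the densities, which is then shown
to be a density on past × tail. Bounded convergence passes `phi` to the limit. -/
theorem exists_subseq_tendsto_info {ks : ℕ → ℕ} (hks : StrictMono ks) :
    ∃ ns : ℕ → ℕ, Tendsto (fun j => ENNReal.ofReal (G.info x m (ks (ns j)))) atTop
      (𝓝 (mutualInfo (G.past m) G.tail (G.walkFrom x))) := by
  obtain ⟨R, hR, h⟩ := G.exists_inv_pn_le x m
  have hS := fun k => G.pastProd_le m (G.future_le (m + k))
  have hd := fun k => G.isBddDensity_infoDensity x m k hR h
  obtain ⟨ns, hns, hae⟩ := exists_subseq_tendsto_density (fun j => hS (ks j))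
    ((G.antitone_pastProd_future m).comp_monotone hks.monotone) (fun j => hd (ks j))
  have hmono : StrictMono fun j => ks (ns j) := hks.comp hns
  set π := (G.walkFrom x).prod (G.walkFrom x) with hπ
  -- A limsup is defined everywhere and is visibly tail-measurable in the second path; clipping to
  -- [0, R] gives the pointwise bounds even where there is no convergence.
  let gl : (ℕ → G.V) × (ℕ → G.V) → ℝ := fun w =>
    max 0 (min R (limsup (fun j => G.infoDensity x m (ks (ns j)) w) atTop))
  have hlim : ∀ᵐ w ∂π, Tendsto (fun j => G.infoDensity x m (ks (ns j)) w) atTop (𝓝 (gl w)) := by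
    filter_upwards [hae] with w hw
    obtain ⟨l, hl⟩ := hw
    have h0 : 0 ≤ l := ge_of_tendsto' hl fun j => G.infoDensity_nonneg x m _ w
    have h1 : l ≤ R := le_of_tendsto' hl fun j => G.infoDensity_le x m _ hR h w
    have : gl w = l := by
      simp only [gl]
      rw [hl.limsup_eq, min_eq_right h1, max_eq_right h0]
    rwa [this]
  have htail : G.tail ≤ MeasurableSpace.pi := (G.tail_le_future 0).trans (G.future_le 0)
  have hglm : Measurable[G.pastProd m G.tail] gl := by
    classical
    have hl : Measurable[G.pastProd m G.tail]
        fun w => limsup (fun j => G.infoDensity x m (ks (ns j)) w) atTop :=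
      G.measurable_pastProd m G.tail (f := fun y ω => limsup (fun j =>
        (if G.pn m x y = 0 then 0 else G.pn (ks (ns j)) y (ω (m + ks (ns j))) /
          G.pn (m + ks (ns j)) x (ω (m + ks (ns j))))) atTop) fun y =>
        G.measurable_limsup_tail m hmono fun j z => if G.pn m x y = 0 then 0 else
          G.pn (ks (ns j)) y z / G.pn (m + ks (ns j)) x z
    exact (measurable_const.max (measurable_const.min measurable_id)).comp hl
  have hgl : IsBddDensity (G.pastProd m G.tail) ((G.walkFrom x).map fun ω => (ω, ω)) π R gl := by
    refine ⟨hglm, fun w => le_max_left _ _, fun w => max_le hR (min_le_left _ _), fun A hA => ?_⟩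
    -- `A` lies in all the larger σ-algebras, so every approximating density integrates over `A` to
    -- the same mass.
    have hA' : ∀ k, MeasurableSet[G.pastProd m (G.future (m + k))] A := fun k =>
      sup_le_sup le_rfl (MeasurableSpace.comap_mono (G.tail_le_future (m + k))) A hA
    have hconv : Tendsto (fun j => ∫⁻ w in A, ENNReal.ofReal (G.infoDensity x m (ks (ns j)) w) ∂π)
        atTop (𝓝 (∫⁻ w in A, ENNReal.ofReal (gl w) ∂π)) := by
      refine tendsto_lintegral_of_dominated_convergence (fun _ => ENNReal.ofReal R)
        (fun j => ((hd _).measurable.mono (hS _) le_rfl).ennreal_ofReal)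
        (fun j => Eventually.of_forall fun w => ENNReal.ofReal_le_ofReal ((hd _).le w)) ?_
        (ae_restrict_of_ae (hlim.mono fun w hw => ENNReal.tendsto_ofReal hw))
      simp [ENNReal.mul_eq_top]
    refine tendsto_nhds_unique ?_ hconv
    simp only [← (hd _).measure_eq A (hA' _)]
    exact tendsto_const_nhds
  refine ⟨ns, ?_⟩
  rw [mutualInfo_eq (G.past_le m) htail _ hgl]
  refine ENNReal.tendsto_ofReal ?_
  obtain ⟨C, hC⟩ := (isCompact_Icc (a := (0 : ℝ)) (b := R)).exists_bound_of_continuousOn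
    continuous_phi.continuousOn
  refine tendsto_integral_of_dominated_convergence (fun _ => C)
    (fun j => ((hd _).integrable_phi (hS _)).aestronglyMeasurable) (integrable_const C)
    (fun j => Eventually.of_forall fun w => hC _ ⟨(hd _).nonneg w, (hd _).le w⟩) ?_
  exact hlim.mono fun w hw => (continuous_phi.tendsto _).comp hw

/-- The information which the far future contains about the first `m` steps decreases to that of
the tail. -/
theorem tendsto_info : Tendsto (fun k => ENNReal.ofReal (G.info x m k)) atTop
    (𝓝 (mutualInfo (G.past m) G.tail (G.walkFrom x))) := by
  refine tendsto_of_subseq_tendsto fun ks hks => ?_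
  obtain ⟨φ, -, hφ⟩ := strictMono_subseq_of_tendsto_atTop hks
  obtain ⟨ns, hns⟩ := G.exists_subseq_tendsto_info x m hφ
  exact ⟨fun j => φ (ns j), hns⟩

end LFGraph

end StatGraph

namespace StatGraph

/-! ### Isomorphisms of balls -/

/-- The maps `E` and `E'` are inverse isomorphisms between the balls of radius `r`. -/
structure IsBallMap (r : ℕ) (G H : RootedGraph) (E : G.V → H.V) (E' : H.V → G.V) : Prop where
  root : E G.root = H.root
  root' : E' H.root = G.root
  mem : ∀ u ∈ G.ball r, E u ∈ H.ball r
  mem' : ∀ u ∈ H.ball r, E' u ∈ G.ball r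
  left_inv : ∀ u ∈ G.ball r, E' (E u) = u
  right_inv : ∀ u ∈ H.ball r, E (E' u) = u
  mult : ∀ u ∈ G.ball r, ∀ v ∈ G.ball r, H.mult (E u) (E v) = G.mult u v

theorem RootedGraph.root_mem_ball (G : RootedGraph) (r : ℕ) : G.root ∈ G.ball r := by
  simp [RootedGraph.ball]

theorem RootedGraph.ball_mono (G : RootedGraph) {s r : ℕ} (h : s ≤ r) : G.ball s ⊆ G.ball r :=
  fun u hu => le_trans (show G.simple.dist G.root u ≤ s from hu) h

theorem RootedGraph.finite_ball (G : RootedGraph) (r : ℕ) : (G.ball r).Finite :=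
  G.finite_setOf_dist_le G.root r

theorem RootedGraph.mem_ball_of_path (G : RootedGraph) {ω : ℕ → G.V} (h0 : ω 0 = G.root)
    (h : ∀ n, G.mult (ω n) (ω (n + 1)) ≠ 0) {i r : ℕ} (hi : i ≤ r) : ω i ∈ G.ball r := by
  refine G.ball_mono hi ?_
  induction i with
  | zero => rw [h0]; exact G.root_mem_ball 0
  | succ i ih =>
    exact (G.dist_le_succ_of_mult_ne_zero G.root (h i)).trans
      (Nat.succ_le_succ (ih (by omega)))

namespace IsBallMap

variable {r s : ℕ} {G H K : RootedGraph} {E : G.V → H.V} {E' : H.V → G.V}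
  {F : H.V → K.V} {F' : K.V → H.V}

theorem symm (h : IsBallMap r G H E E') : IsBallMap r H G E' E := by
  refine ⟨h.root', h.root, h.mem', h.mem, h.right_inv, h.left_inv, fun u hu v hv => ?_⟩
  rw [← h.mult _ (h.mem' u hu) _ (h.mem' v hv), h.right_inv u hu, h.right_inv v hv]

theorem trans (h : IsBallMap r G H E E') (k : IsBallMap r H K F F') :
    IsBallMap r G K (F ∘ E) (E' ∘ F') where
  root := by simp [h.root, k.root]
  root' := by simp [h.root', k.root']
  mem u hu := k.mem _ (h.mem u hu)
  mem' u hu := h.mem' _ (k.mem' u hu)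
  left_inv u hu := by
    simp only [Function.comp_apply]
    rw [k.left_inv _ (h.mem u hu), h.left_inv u hu]
  right_inv u hu := by
    simp only [Function.comp_apply]
    rw [h.right_inv _ (k.mem' u hu), k.right_inv u hu]
  mult u hu v hv := by
    simp only [Function.comp_apply]
    rw [k.mult _ (h.mem u hu) _ (h.mem v hv), h.mult u hu v hv]

/-- Edges along a geodesic from the root stay in the ball and are preserved, so distance to the root
cannot increase. -/
theorem mem_of_le (h : IsBallMap r G H E E') (hs : s ≤ r) {u : G.V} (hu : u ∈ G.ball s) :
    E u ∈ H.ball s := by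
  induction s generalizing u with
  | zero =>
    have : G.root = u := G.connected.dist_eq_zero_iff.1 (Nat.le_zero.1 hu)
    rw [← this, h.root]
    exact H.root_mem_ball 0
  | succ s ih =>
    rcases G.exists_mult_ne_zero_of_dist_le_succ hu with h1 | ⟨z, hz, hzu⟩
    · exact H.ball_mono s.le_succ (ih (by omega) h1)
    · have hz' := ih (by omega) hz
      have hm := h.mult z (G.ball_mono (by omega) hz) u (G.ball_mono hs hu)
      exact (H.dist_le_succ_of_mult_ne_zero H.root (by rwa [hm])).trans (Nat.succ_le_succ hz')

theorem mono (h : IsBallMap r G H E E') (hs : s ≤ r) : IsBallMap s G H E E' where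
  root := h.root
  root' := h.root'
  mem _ hu := h.mem_of_le hs hu
  mem' _ hu := h.symm.mem_of_le hs hu
  left_inv u hu := h.left_inv u (G.ball_mono hs hu)
  right_inv u hu := h.right_inv u (H.ball_mono hs hu)
  mult u hu v hv := h.mult u (G.ball_mono hs hu) v (G.ball_mono hs hv)

/-- The extra unit of radius makes all neighbours of `u` visible. -/
theorem deg_eq (h : IsBallMap (r + 1) G H E E') {u : G.V} (hu : u ∈ G.ball r) :
    H.deg (E u) = G.deg u := by
  have hu1 := G.ball_mono r.le_succ hu
  have hn : ∀ v ∈ G.nbrs u, v ∈ G.ball (r + 1) := fun v hv =>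
    (G.dist_le_succ_of_mult_ne_zero G.root (G.mem_nbrs.1 hv)).trans (Nat.succ_le_succ hu)
  have hn' : ∀ v ∈ H.nbrs (E u), v ∈ H.ball (r + 1) := fun v hv =>
    (H.dist_le_succ_of_mult_ne_zero H.root (H.mem_nbrs.1 hv)).trans
      (Nat.succ_le_succ (h.mem_of_le r.le_succ hu))
  unfold LFGraph.deg
  refine Finset.sum_nbij' E' E (fun v hv => ?_) (fun v hv => ?_) (fun v hv => ?_) (fun v hv => ?_)
    fun v hv => ?_
  · rw [LFGraph.mem_nbrs, ← h.mult u hu1 _ (h.mem' v (hn' v hv)), h.right_inv v (hn' v hv)]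
    exact H.mem_nbrs.1 hv
  · rw [LFGraph.mem_nbrs, h.mult u hu1 v (hn v hv)]
    exact G.mem_nbrs.1 hv
  · exact h.right_inv v (hn' v hv)
  · exact h.left_inv v (hn v hv)
  · rw [← h.mult u hu1 _ (h.mem' v (hn' v hv)), h.right_inv v (hn' v hv)]

theorem p_eq (h : IsBallMap (r + 1) G H E E') {u v : G.V} (hu : u ∈ G.ball r)
    (hv : v ∈ G.ball (r + 1)) : H.p (E u) (E v) = G.p u v := by
  unfold LFGraph.p
  rw [h.deg_eq hu, h.mult u (G.ball_mono r.le_succ hu) v hv]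

theorem ae_mem_ball (G : RootedGraph) (r : ℕ) :
    ∀ᵐ ω ∂G.walkFrom G.root, ∀ i ≤ r, ω i ∈ G.ball r := by
  filter_upwards [G.ae_path G.root] with ω hω i hi
  exact G.mem_ball_of_path hω.1 hω.2 hi

/-- An isomorphism of balls maps the law of the first steps of the walk to that of the walk on the
other graph. -/
theorem map_init_eq (h : IsBallMap r G H E E') :
    (G.walkFrom G.root).map (fun ω => H.init r fun i => E (ω i)) =
      (H.walkFrom H.root).map (H.init r) := by
  classical
  have hE : Measurable fun ω : ℕ → G.V => fun i => E (ω i) :=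
    measurable_pi_lambda _ fun i => (measurable_from_top (f := E)).comp (measurable_pi_apply i)
  have hcomp : (G.walkFrom G.root).map (fun ω => H.init r fun i => E (ω i)) =
      ((G.walkFrom G.root).map fun ω => fun i => E (ω i)).map (H.init r) :=
    (Measure.map_map (H.measurable_init r) hE).symm
  rw [hcomp]
  refine LFGraph.map_frestrictLe_ext fun a => ?_
  rw [Measure.map_apply hE (LFGraph.measurableSet_cyl r a)]
  by_cases ha : ∀ i ≤ r, a i ∈ H.ball r
  · have hset : G.walkFrom G.root ((fun ω : ℕ → G.V => fun i => E (ω i)) ⁻¹' H.cyl r a) =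
        G.walkFrom G.root (G.cyl r fun i => E' (a i)) := by
      refine measure_congr ?_
      filter_upwards [ae_mem_ball G r] with ω hω
      refine propext ⟨fun h1 i hi => ?_, fun h1 i hi => ?_⟩
      · rw [← h.left_inv _ (hω i hi)]
        exact congrArg E' (h1 i hi)
      · exact (congrArg E (h1 i hi)).trans (h.right_inv _ (ha i hi))
    rw [hset, LFGraph.walkFrom_cyl, LFGraph.walkFrom_cyl]
    by_cases hp : a 0 = H.root ∧ ∀ i < r, H.mult (a i) (a (i + 1)) ≠ 0
    -- The position at time `i` lies within distance `i`, so the step from it only needs degrees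
    -- visible in the ball of radius i + 1 ≤ r.
    · have hball : ∀ i ≤ r, a i ∈ H.ball i := by
        intro i hi
        induction i with
        | zero => rw [hp.1]; exact H.root_mem_ball 0
        | succ i ih =>
          exact (H.dist_le_succ_of_mult_ne_zero H.root (hp.2 i hi)).trans
            (Nat.succ_le_succ (ih (by omega)))
      rw [if_pos hp.1, hp.1, if_pos h.root']
      congr 1
      refine Finset.prod_congr rfl fun i hi => ?_
      have hi' := Finset.mem_range.1 hi
      have h2 : IsBallMap (i + 1) G H E E' := h.mono hi'
      rw [h2.symm.p_eq (hball i hi'.le) (hball (i + 1) hi')]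
    · by_cases h0 : a 0 = H.root
      · obtain ⟨i, hi, hi0⟩ : ∃ i < r, H.mult (a i) (a (i + 1)) = 0 := by
          by_contra hcon
          push Not at hcon
          exact hp ⟨h0, hcon⟩
        have hi0' : G.mult (E' (a i)) (E' (a (i + 1))) = 0 := by
          rw [h.symm.mult _ (ha i hi.le) _ (ha (i + 1) hi), hi0]
        rw [Finset.prod_eq_zero (Finset.mem_range.2 hi) (by simp [LFGraph.p, hi0']),
          Finset.prod_eq_zero (Finset.mem_range.2 hi) (by simp [LFGraph.p, hi0])]
        simp
      · have h0' : E' (a 0) ≠ G.root := by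
          intro h1
          refine h0 ?_
          rw [← h.right_inv _ (ha 0 (Nat.zero_le _)), h1, h.root]
        rw [if_neg h0, if_neg h0', zero_mul, zero_mul]
  · push Not at ha
    obtain ⟨i, hi, hai⟩ := ha
    have h1 : G.walkFrom G.root ((fun ω : ℕ → G.V => fun i => E (ω i)) ⁻¹' H.cyl r a) = 0 := by
      refine measure_mono_null (fun ω hω => ?_) (ae_mem_ball G r)
      intro hcon
      refine hai ?_
      rw [← show E (ω i) = a i from hω i hi]
      exact h.mem _ (hcon i hi)
    have h2 : H.walkFrom H.root (H.cyl r a) = 0 := by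
      refine measure_mono_null (fun ω hω => ?_) (ae_mem_ball H r)
      intro hcon
      exact hai (by rw [← hω i hi]; exact hcon i hi)
    rw [h1, h2]

theorem pn_eq (h : IsBallMap r G H E E') {y : G.V} (hy : y ∈ G.ball r) :
    H.pn r H.root (E y) = G.pn r G.root y := by
  have hE : Measurable fun ω : ℕ → G.V => H.init r fun i => E (ω i) :=
    (H.measurable_init r).comp (measurable_pi_lambda _ fun i =>
      (measurable_from_top (f := E)).comp (measurable_pi_apply i))
  have h1 := congrArg (fun μ => μ {b | b ⟨r, Finset.mem_Iic.2 le_rfl⟩ = E y}) h.map_init_eq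
  have hm : MeasurableSet {b : (i : Finset.Iic r) → H.V | b ⟨r, Finset.mem_Iic.2 le_rfl⟩ = E y} :=
    measurable_pi_apply (X := fun _ : Finset.Iic r => H.V) _ (measurableSet_singleton (E y))
  simp only [Measure.map_apply hE hm, Measure.map_apply (H.measurable_init r) hm] at h1
  have h2 : G.walkFrom G.root {ω | ω r = y} = H.walkFrom H.root {ω | ω r = E y} := by
    refine Eq.trans (measure_congr ?_) h1
    filter_upwards [ae_mem_ball G r] with ω hω
    refine propext ⟨fun h3 => congrArg E h3, fun h3 => ?_⟩
    have h4 := congrArg E' (show E (ω r) = E y from h3)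
    rwa [h.left_inv _ hy, h.left_inv _ (hω r le_rfl)] at h4
  rw [LFGraph.walkFrom_coord, LFGraph.walkFrom_coord] at h2
  exact ((ENNReal.ofReal_eq_ofReal_iff (G.pn_nonneg _ _ _) (H.pn_nonneg _ _ _)).1 h2).symm

/-- The bijection is extended to all vertices by sending everything outside the ball to the root. -/
theorem of_equiv {e : G.ball r ≃ H.ball r} (he : RootedGraph.IsBallIso G H e) :
    ∃ E E', IsBallMap r G H E E' ∧ ∀ u : G.ball r, E u = e u := by
  classical
  have hroot : e ⟨G.root, G.root_mem_ball r⟩ = ⟨H.root, H.root_mem_ball r⟩ :=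
    Subtype.ext (he.1 _ rfl)
  let E : G.V → H.V := fun u => if h : u ∈ G.ball r then e ⟨u, h⟩ else H.root
  let E' : H.V → G.V := fun u => if h : u ∈ H.ball r then e.symm ⟨u, h⟩ else G.root
  have hE : ∀ u (hu : u ∈ G.ball r), E u = e ⟨u, hu⟩ := fun u hu => dif_pos hu
  have hE' : ∀ u (hu : u ∈ H.ball r), E' u = e.symm ⟨u, hu⟩ := fun u hu => dif_pos hu
  refine ⟨E, E', ⟨?_, ?_, fun u hu => ?_, fun u hu => ?_, fun u hu => ?_, fun u hu => ?_,
    fun u hu v hv => ?_⟩, fun u => hE u u.2⟩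
  · rw [hE _ (G.root_mem_ball r), hroot]
  · rw [hE' _ (H.root_mem_ball r), ← hroot, Equiv.symm_apply_apply]
  · rw [hE u hu]; exact (e ⟨u, hu⟩).2
  · rw [hE' u hu]; exact (e.symm ⟨u, hu⟩).2
  · rw [hE u hu, hE' _ (e ⟨u, hu⟩).2]; simp
  · rw [hE' u hu, hE _ (e.symm ⟨u, hu⟩).2]; simp
  · rw [hE u hu, hE v hv, he.2]

theorem exists_equiv (h : IsBallMap r G H E E') :
    ∃ e : G.ball r ≃ H.ball r, RootedGraph.IsBallIso G H e ∧ ∀ u : G.ball r, (e u : H.V) = E u :=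
  ⟨⟨fun u => ⟨E u, h.mem u u.2⟩, fun u => ⟨E' u, h.mem' u u.2⟩,
    fun u => Subtype.ext (h.left_inv u u.2), fun u => Subtype.ext (h.right_inv u u.2)⟩,
    ⟨fun u hu => by simp [hu, h.root], fun u v => h.mult u u.2 v v.2⟩, fun _ => rfl⟩

end IsBallMap

theorem RootedGraph.sameBall_iff {r : ℕ} {G H : RootedGraph} :
    G.SameBall r H ↔ ∃ E E', IsBallMap r G H E E' := by
  constructor
  · rintro ⟨e, he⟩
    obtain ⟨E, E', h, -⟩ := IsBallMap.of_equiv he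
    exact ⟨E, E', h⟩
  · rintro ⟨E, E', h⟩
    obtain ⟨e, he, -⟩ := h.exists_equiv
    exact ⟨e, he⟩

/-- An isomorphism of balls maps the first `r` steps of `ω` to those of the path of `v`. -/
def PathMatches (r : ℕ) (G : RootedGraph) (ω : ℕ → G.V) (v : RootedPath) : Prop :=
  ∃ E E', IsBallMap r G v.toRootedGraph E E' ∧ ∀ i ≤ r, E (ω i) = v.path i

namespace RootedPath

theorem mem_ball (w : RootedPath) {i r : ℕ} (hi : i ≤ r) : w.path i ∈ w.ball r :=
  w.mem_ball_of_path w.path_zero w.path_adj hi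

theorem sameBall_iff {r : ℕ} {w v : RootedPath} :
    w.SameBall r v ↔ PathMatches r w.toRootedGraph w.path v := by
  constructor
  · rintro ⟨e, he, hp⟩
    obtain ⟨E, E', h, hE⟩ := IsBallMap.of_equiv he
    refine ⟨E, E', h, fun i hi => ?_⟩
    rw [← hp ⟨w.path i, w.mem_ball hi⟩ i hi rfl, ← hE]
  · rintro ⟨E, E', h, hE⟩
    obtain ⟨e, he, heE⟩ := h.exists_equiv
    exact ⟨e, he, fun u i hi hu => by rw [heE, hu, hE i hi]⟩

theorem SameBall.symm {r : ℕ} {w v : RootedPath} (h : w.SameBall r v) : v.SameBall r w := by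
  obtain ⟨E, E', hE, hp⟩ := sameBall_iff.1 h
  refine sameBall_iff.2 ⟨E', E, hE.symm, fun i hi => ?_⟩
  rw [← hp i hi, hE.left_inv _ (w.mem_ball hi)]

theorem SameBall.trans {r : ℕ} {w v u : RootedPath} (h : w.SameBall r v) (k : v.SameBall r u) :
    w.SameBall r u := by
  obtain ⟨E, E', hE, hp⟩ := sameBall_iff.1 h
  obtain ⟨F, F', hF, hq⟩ := sameBall_iff.1 k
  exact sameBall_iff.2 ⟨_, _, hE.trans hF, fun i hi => by
    rw [Function.comp_apply, hp i hi, hq i hi]⟩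

theorem SameBall.mono {r s : ℕ} {w v : RootedPath} (h : w.SameBall r v) (hs : s ≤ r) :
    w.SameBall s v := by
  obtain ⟨E, E', hE, hp⟩ := sameBall_iff.1 h
  exact sameBall_iff.2 ⟨E, E', hE.mono hs, fun i hi => hp i (hi.trans hs)⟩

end RootedPath

/-! ### Measurability for the local topology -/

/-- A function which is constant on the classes of a relation with countably many measurable
classes is measurable. -/
theorem measurable_of_countable_classes {X C β : Type*} [MeasurableSpace X] [MeasurableSpace β]
    [Countable C] {rel : X → X → Prop}
    (hmeas : ∀ v, MeasurableSet {w | rel w v})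
    {realizes : C → X → Prop} (hex : ∀ w, ∃ c, realizes c w)
    (hr : ∀ c w v, realizes c w → realizes c v → rel w v) {f : X → β}
    (hf : ∀ w v, rel w v → f w = f v) : Measurable f := by
  intro s _
  have hset : f ⁻¹' s = ⋃ c : C, ⋃ h : ∃ v, realizes c v ∧ f v ∈ s, {w | rel w h.choose} := by
    ext w
    simp only [Set.mem_preimage, Set.mem_iUnion, Set.mem_ofPred_eq]
    constructor
    · intro hw
      obtain ⟨c, hc⟩ := hex w
      exact ⟨c, ⟨w, hc, hw⟩, hr c _ _ hc (Exists.choose_spec (⟨w, hc, hw⟩ :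
        ∃ v, realizes c v ∧ f v ∈ s)).1⟩
    · rintro ⟨c, h, hw⟩
      rw [hf _ _ hw]
      exact h.choose_spec.2
  rw [hset]
  exact MeasurableSet.iUnion fun c => MeasurableSet.iUnion fun h => hmeas _

theorem RootedPath.measurableSet_sameBall (r : ℕ) (v : RootedPath) :
    MeasurableSet {w : RootedPath | w.SameBall r v} :=
  MeasurableSpace.measurableSet_generateFrom ⟨r, v, rfl⟩

theorem RootedGraph.measurableSet_sameBall (r : ℕ) (v : RootedGraph) :
    MeasurableSet {G : RootedGraph | G.SameBall r v} :=
  MeasurableSpace.measurableSet_generateFrom ⟨r, v, rfl⟩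

/-- Numbering the vertices of a finite ball encodes it by its size, the index of the root and a
matrix of multiplicities, so there are countably many classes. -/
theorem RootedGraph.measurable_of_sameBall {β : Type*} [MeasurableSpace β] (r : ℕ)
    {f : RootedGraph → β} (hf : ∀ G H : RootedGraph, G.SameBall r H → f G = f H) :
    Measurable f := by
  refine measurable_of_countable_classes (C := Σ n : ℕ, Fin n × (Fin n → Fin n → ℕ))
    (rel := RootedGraph.SameBall r)
    (realizes := fun c G => ∃ σ : G.ball r ≃ Fin c.1, σ ⟨G.root, G.root_mem_ball r⟩ = c.2.1 ∧
      ∀ u v : G.ball r, G.mult u v = c.2.2 (σ u) (σ v))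
    (RootedGraph.measurableSet_sameBall r) (fun G => ?_)
    (fun c G H => ?_) hf
  · have := (G.finite_ball r).to_subtype
    obtain ⟨n, ⟨σ⟩⟩ := Finite.exists_equiv_fin (G.ball r)
    exact ⟨⟨n, σ ⟨G.root, G.root_mem_ball r⟩, fun i j => G.mult (σ.symm i) (σ.symm j)⟩, σ, rfl,
      fun u v => by simp⟩
  · rintro ⟨σ, h1, h2⟩ ⟨τ, k1, k2⟩
    refine ⟨σ.trans τ.symm, fun u hu => ?_, fun u v => ?_⟩
    · have : u = ⟨G.root, G.root_mem_ball r⟩ := Subtype.ext hu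
      rw [this, Equiv.trans_apply, h1, ← k1, Equiv.symm_apply_apply]
    · rw [h2, k2]
      simp

theorem RootedPath.measurable_of_sameBall {β : Type*} [MeasurableSpace β] (r : ℕ)
    {f : RootedPath → β} (hf : ∀ w v : RootedPath, w.SameBall r v → f w = f v) :
    Measurable f := by
  refine measurable_of_countable_classes
    (C := Σ n : ℕ, Fin n × (Fin n → Fin n → ℕ) × (Fin (r + 1) → Fin n))
    (rel := RootedPath.SameBall r)
    (realizes := fun c w => ∃ σ : w.ball r ≃ Fin c.1, σ ⟨w.root, w.root_mem_ball r⟩ = c.2.1 ∧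
      (∀ u v : w.ball r, w.mult u v = c.2.2.1 (σ u) (σ v)) ∧
      ∀ i : Fin (r + 1), σ ⟨w.path i, w.mem_ball (Nat.lt_succ_iff.1 i.2)⟩ = c.2.2.2 i)
    (RootedPath.measurableSet_sameBall r) (fun w => ?_)
    (fun c w v => ?_) hf
  · have := (w.finite_ball r).to_subtype
    obtain ⟨n, ⟨σ⟩⟩ := Finite.exists_equiv_fin (w.ball r)
    exact ⟨⟨n, σ ⟨w.root, w.root_mem_ball r⟩, fun i j => w.mult (σ.symm i) (σ.symm j),
      fun i => σ ⟨w.path i, w.mem_ball (Nat.lt_succ_iff.1 i.2)⟩⟩, σ, rfl,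
      fun u v => by simp, fun i => rfl⟩
  · rintro ⟨σ, h1, h2, h3⟩ ⟨τ, k1, k2, k3⟩
    refine ⟨σ.trans τ.symm, ⟨fun u hu => ?_, fun u v => ?_⟩, fun u i hi hu => ?_⟩
    · have : u = ⟨w.root, w.root_mem_ball r⟩ := Subtype.ext hu
      rw [this, Equiv.trans_apply, h1, ← k1, Equiv.symm_apply_apply]
    · rw [h2, k2]
      simp
    · have : u = ⟨w.path i, w.mem_ball hi⟩ := Subtype.ext hu
      rw [this, Equiv.trans_apply, h3 ⟨i, Nat.lt_succ_iff.2 hi⟩, ← k3 ⟨i, Nat.lt_succ_iff.2 hi⟩,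
        Equiv.symm_apply_apply]

theorem RootedPath.measurable_negLog (n : ℕ) : Measurable (RootedPath.negLog n) := by
  refine RootedPath.measurable_of_sameBall n fun w v h => ?_
  obtain ⟨E, E', hE, hp⟩ := RootedPath.sameBall_iff.1 h
  unfold RootedPath.negLog
  rw [w.path_zero, v.path_zero, ← hp n le_rfl, hE.pn_eq (w.mem_ball le_rfl)]

/-! ### The law of the walk depends measurably on the rooted graph. -/

namespace PathMatches

variable {r : ℕ} {G H : RootedGraph} {v : RootedPath}

theorem congr_init {ω ω' : ℕ → G.V} (h : G.init r ω = G.init r ω') :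
    PathMatches r G ω v ↔ PathMatches r G ω' v := by
  have h' : ∀ i ≤ r, ω i = ω' i := fun i hi => congrFun h ⟨i, Finset.mem_Iic.2 hi⟩
  refine exists_congr fun E => exists_congr fun E' => and_congr_right fun _ =>
    forall₂_congr fun i hi => ?_
  rw [h' i hi]

theorem setOf_eq_preimage (r : ℕ) (G : RootedGraph) (v : RootedPath) :
    {ω | PathMatches r G ω v} = G.init r ⁻¹' (G.init r '' {ω | PathMatches r G ω v}) := by
  refine (Set.subset_preimage_image _ _).antisymm ?_
  rintro ω ⟨ω', h, hω⟩
  exact (congr_init hω).1 h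

theorem measurableSet_setOf (r : ℕ) (G : RootedGraph) (v : RootedPath) :
    MeasurableSet {ω | PathMatches r G ω v} := by
  rw [setOf_eq_preimage]
  exact G.measurable_init r (Set.to_countable _).measurableSet

theorem comp_iff {E : G.V → H.V} {E' : H.V → G.V} (h : IsBallMap r G H E E') {ω : ℕ → G.V}
    (hω : ∀ i ≤ r, ω i ∈ G.ball r) :
    PathMatches r H (fun i => E (ω i)) v ↔ PathMatches r G ω v := by
  constructor
  · rintro ⟨F, F', hF, hp⟩
    exact ⟨_, _, h.trans hF, hp⟩
  · rintro ⟨F, F', hF, hp⟩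
    refine ⟨_, _, h.symm.trans hF, fun i hi => ?_⟩
    rw [Function.comp_apply, h.left_inv _ (hω i hi), hp i hi]

theorem walkFrom_eq {E : G.V → H.V} {E' : H.V → G.V} (h : IsBallMap r G H E E') :
    G.walkFrom G.root {ω | PathMatches r G ω v} = H.walkFrom H.root {ω | PathMatches r H ω v} := by
  have hE : Measurable fun ω : ℕ → G.V => H.init r fun i => E (ω i) :=
    (H.measurable_init r).comp (measurable_pi_lambda _ fun i =>
      (measurable_from_top (f := E)).comp (measurable_pi_apply i))
  have hm : MeasurableSet (H.init r '' {ω | PathMatches r H ω v}) :=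
    (Set.to_countable _).measurableSet
  have h1 := congrArg (fun μ => μ (H.init r '' {ω | PathMatches r H ω v})) h.map_init_eq
  simp only [Measure.map_apply hE hm, Measure.map_apply (H.measurable_init r) hm] at h1
  rw [← setOf_eq_preimage] at h1
  rw [← h1]
  refine measure_congr ?_
  filter_upwards [IsBallMap.ae_mem_ball G r] with ω hω
  refine propext ((comp_iff (v := v) h hω).symm.trans ?_)
  exact Set.ext_iff.1 (setOf_eq_preimage r H v) _

end PathMatches

namespace RootedGraph

variable (G : RootedGraph)

theorem measurableSet_paths : MeasurableSet G.Paths := by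
  have h : ∀ n, MeasurableSet {ω : ℕ → G.V | G.mult (ω n) (ω (n + 1)) ≠ 0} := by
    intro n
    have h1 : Measurable fun ω : ℕ → G.V => (ω n, ω (n + 1)) :=
      (measurable_pi_apply n).prodMk (measurable_pi_apply (n + 1))
    exact h1 (DiscreteMeasurableSpace.forall_measurableSet {q : G.V × G.V | G.mult q.1 q.2 ≠ 0})
  have hset : G.Paths = {ω | ω 0 = G.root} ∩ ⋂ n, {ω | G.mult (ω n) (ω (n + 1)) ≠ 0} := by
    ext ω
    simp [Paths]
  rw [hset]
  exact (G.measurableSet_coord 0 G.root).inter (MeasurableSet.iInter h)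

theorem measurable_withPath : Measurable G.withPath := by
  refine measurable_generateFrom ?_
  rintro _ ⟨r, v, rfl⟩
  have hset : G.withPath ⁻¹' {w | w.SameBall r v} =
      Subtype.val ⁻¹' {ω | PathMatches r G ω v} := by
    ext ω
    exact RootedPath.sameBall_iff
  rw [hset]
  exact measurable_subtype_coe (PathMatches.measurableSet_setOf r G v)

theorem lintegral_walkOn {f : RootedPath → ℝ≥0∞} (hf : Measurable f) {F : (ℕ → G.V) → ℝ≥0∞}
    (hF : ∀ ω : G.Paths, f (G.withPath ω) = F ω) :
    ∫⁻ w, f w ∂walkOn G = ∫⁻ ω, F ω ∂G.walkFrom G.root := by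
  rw [walkOn, lintegral_map hf G.measurable_withPath]
  simp only [hF]
  rw [lintegral_subtype_comap G.measurableSet_paths,
    Measure.restrict_eq_self_of_ae_mem (s := G.Paths) (G.ae_path G.root)]

theorem walkOn_apply {A : Set RootedPath} (hA : MeasurableSet A) {B : Set (ℕ → G.V)}
    (hB : MeasurableSet B) (h : ∀ ω : G.Paths, G.withPath ω ∈ A ↔ (ω : ℕ → G.V) ∈ B) :
    walkOn G A = G.walkFrom G.root B := by
  classical
  have := G.lintegral_walkOn (f := A.indicator 1) (F := B.indicator 1)
    (measurable_one.indicator hA) fun ω => by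
      simp only [Set.indicator_apply, h ω]
      rfl
  rwa [lintegral_indicator_one hA, lintegral_indicator_one hB] at this

instance : IsProbabilityMeasure (walkOn G) :=
  ⟨by rw [G.walkOn_apply MeasurableSet.univ MeasurableSet.univ fun _ => by simp, measure_univ]⟩

end RootedGraph

/-- The generating sets form a π-system: if two of them meet at `w`, their intersection is the class
of `w` for the larger radius. The mass of each depends only on a finite ball. -/
theorem measurable_walkOn : Measurable walkOn := by
  refine Measurable.measure_of_isPiSystem_of_isProbabilityMeasure (S := {S | ∃ (r : ℕ)
    (v : RootedPath), S = {w | RootedPath.SameBall r w v}}) rfl ?_ ?_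
  · rintro _ ⟨r, v, rfl⟩ _ ⟨s, u, rfl⟩ ⟨w, hwv, hwu⟩
    refine ⟨max r s, w, Set.ext fun w' => ⟨fun h => ?_, fun h => ?_⟩⟩
    · rcases le_total r s with hrs | hrs
      · rw [max_eq_right hrs]
        exact RootedPath.SameBall.trans h.2 (RootedPath.SameBall.symm hwu)
      · rw [max_eq_left hrs]
        exact RootedPath.SameBall.trans h.1 (RootedPath.SameBall.symm hwv)
    · have h' : w'.SameBall (max r s) w := h
      exact ⟨(h'.mono (le_max_left _ _)).trans hwv, (h'.mono (le_max_right _ _)).trans hwu⟩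
  · rintro _ ⟨r, v, rfl⟩
    refine RootedGraph.measurable_of_sameBall r fun G H h => ?_
    have hA := RootedPath.measurableSet_sameBall r v
    obtain ⟨E, E', hE⟩ := RootedGraph.sameBall_iff.1 h
    rw [G.walkOn_apply hA (PathMatches.measurableSet_setOf r G v)
      fun ω => RootedPath.sameBall_iff, H.walkOn_apply hA (PathMatches.measurableSet_setOf r H v)
      fun ω => RootedPath.sameBall_iff]
    exact PathMatches.walkFrom_eq hE

end StatGraph

namespace StatGraph

/-! ### Entropy of stationary random graphs -/

namespace RootedPath

theorem negLog_zero (w : RootedPath) : negLog 0 w = 0 := by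
  simp [negLog, LFGraph.pn]

theorem negLog_nonneg (n : ℕ) (w : RootedPath) : 0 ≤ negLog n w :=
  neg_nonneg.2 (Real.log_nonpos (w.pn_nonneg _ _ _) (w.pn_le_one _ _ _))

theorem negLog_iterate_shift (m n : ℕ) (w : RootedPath) :
    negLog n (shift^[m] w) = -Real.log (w.pn n (w.path m) (w.path (m + n))) := by
  induction m generalizing w with
  | zero => simp [negLog]
  | succ m ih =>
    rw [Function.iterate_succ_apply, ih, Nat.add_right_comm]
    rfl

theorem negLog_add_le (n m : ℕ) (w : RootedPath) :
    negLog (n + m) w ≤ negLog n w + negLog m (shift^[n] w) := by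
  rw [negLog_iterate_shift, negLog, negLog]
  have h1 := w.pn_pos_of_path w.path_adj 0 n
  have h2 := w.pn_pos_of_path w.path_adj n m
  rw [zero_add] at h1
  have h3 := Real.log_le_log (mul_pos h1 h2)
    (w.pn_mul_pn_le n m (w.path 0) (w.path n) (w.path (n + m)))
  rw [Real.log_mul h1.ne' h2.ne'] at h3
  linarith

end RootedPath

/-! ### Information and mean logarithms on a fixed graph. -/

section Graph

variable (G : RootedGraph)

theorem lintegral_negLog_iterate_shift {m k : ℕ}
    (hm : Measurable fun w : RootedPath => RootedPath.negLog k (RootedPath.shift^[m] w)) :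
    ∫⁻ w, ENNReal.ofReal (RootedPath.negLog k (RootedPath.shift^[m] w)) ∂walkOn G =
      ENNReal.ofReal (∫ ω, -Real.log (G.pn k (ω m) (ω (m + k))) ∂G.walkFrom G.root) := by
  rw [G.lintegral_walkOn hm.ennreal_ofReal
    (F := fun ω => ENNReal.ofReal (-Real.log (G.pn k (ω m) (ω (m + k))))) fun ω => by
      rw [RootedPath.negLog_iterate_shift]
      rfl]
  refine (ofReal_integral_eq_lintegral_ofReal
    (G.integrable_coord G.root m (m + k) fun y z => -Real.log (G.pn k y z))
    (Eventually.of_forall fun ω => ?_)).symm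
  exact neg_nonneg.2 (Real.log_nonpos (G.pn_nonneg _ _ _) (G.pn_le_one _ _ _))

theorem lintegral_negLog (n : ℕ) :
    ∫⁻ w, ENNReal.ofReal (RootedPath.negLog n w) ∂walkOn G =
      ENNReal.ofReal (∫ ω, -Real.log (G.pn n G.root (ω n)) ∂G.walkFrom G.root) := by
  have h := lintegral_negLog_iterate_shift G (m := 0) (k := n)
    (by simpa using RootedPath.measurable_negLog n)
  simp only [Function.iterate_zero, id_eq, zero_add] at h
  rw [h]
  congr 1
  refine integral_congr_ae ?_
  filter_upwards [G.walkFrom_coord_zero G.root] with ω hω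
  rw [hω]

theorem ofReal_info_add {m k : ℕ}
    (hm : Measurable fun w : RootedPath => RootedPath.negLog k (RootedPath.shift^[m] w)) :
    ENNReal.ofReal (G.info G.root m k) +
      ∫⁻ w, ENNReal.ofReal (RootedPath.negLog k (RootedPath.shift^[m] w)) ∂walkOn G =
    ∫⁻ w, ENNReal.ofReal (RootedPath.negLog (m + k) w) ∂walkOn G := by
  rw [lintegral_negLog_iterate_shift G hm, lintegral_negLog, ← ENNReal.ofReal_add
    (G.info_nonneg _ _ _) (integral_nonneg fun ω => neg_nonneg.2
      (Real.log_nonpos (G.pn_nonneg _ _ _) (G.pn_le_one _ _ _))), G.info_eq, sub_add_cancel]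

theorem lintegral_negLog_iterate_shift_ne_top {m k : ℕ}
    (hm : Measurable fun w : RootedPath => RootedPath.negLog k (RootedPath.shift^[m] w)) :
    ∫⁻ w, ENNReal.ofReal (RootedPath.negLog k (RootedPath.shift^[m] w)) ∂walkOn G ≠ ∞ := by
  rw [lintegral_negLog_iterate_shift G hm]
  exact ENNReal.ofReal_ne_top

/-- Subadditivity combined with the identity of `ofReal_info_add`, after cancelling a finite term.
The bound is uniform in `k` and serves as the dominating function over graphs. -/
theorem ofReal_info_le {m k : ℕ}
    (hm : Measurable fun w : RootedPath => RootedPath.negLog k (RootedPath.shift^[m] w)) :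
    ENNReal.ofReal (G.info G.root m k) ≤
      ∫⁻ w, ENNReal.ofReal (RootedPath.negLog m w) ∂walkOn G := by
  refine (ENNReal.add_le_add_iff_right (lintegral_negLog_iterate_shift_ne_top G hm)).1 ?_
  rw [ofReal_info_add G hm, ← lintegral_add_left (RootedPath.measurable_negLog m).ennreal_ofReal]
  refine lintegral_mono fun w => ?_
  rw [← ENNReal.ofReal_add (RootedPath.negLog_nonneg _ _) (RootedPath.negLog_nonneg _ _)]
  exact ENNReal.ofReal_le_ofReal (RootedPath.negLog_add_le m k w)

end Graph

/-- If `a n / n` tends to `h`, then the increments of `a` over `m` steps can only tend to `m h`. -/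
theorem eq_mul_of_tendsto_sub_of_tendsto_div {a : ℕ → ℝ} (h0 : a 0 = 0) {m : ℕ} (hm : 1 ≤ m)
    {i h : ℝ} (hsub : Tendsto (fun k => a (m + k) - a k) atTop (𝓝 i))
    (hdiv : Tendsto (fun n : ℕ => a n / n) atTop (𝓝 h)) : i = m * h := by
  have hmul : Tendsto (fun j : ℕ => m * j) atTop atTop := tendsto_id.const_mul_atTop' hm
  -- Along k = m j the increments telescope to a (m n), and their Cesàro means keep the limit `i`.
  have hcesaro := (hsub.comp hmul).cesaro
  have hsum : ∀ n : ℕ, ∑ j ∈ Finset.range n, ((fun k => a (m + k) - a k) ∘ fun j => m * j) j =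
      a (m * n) := by
    intro n
    have := Finset.sum_range_sub (fun j => a (m * j)) n
    simp only [mul_zero, h0, sub_zero] at this
    rw [← this]
    refine Finset.sum_congr rfl fun j _ => ?_
    simp only [Function.comp_apply]
    rw [Nat.mul_succ, add_comm]
  simp only [hsum] at hcesaro
  refine tendsto_nhds_unique hcesaro (((hdiv.comp hmul).const_mul (m : ℝ)).congr fun n => ?_)
  have hm0 : (m : ℝ) ≠ 0 := by exact_mod_cast (by omega : m ≠ 0)
  rw [Function.comp_apply, Nat.cast_mul, mul_div_assoc', mul_div_mul_left _ _ hm0, div_eq_inv_mul]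

/-! ### Averaging over the random graph. -/

section Stationary

variable {μ : Measure RootedGraph}

theorem lintegral_walkLaw {f : RootedPath → ℝ≥0∞} (hf : Measurable f) :
    ∫⁻ w, f w ∂walkLaw μ = ∫⁻ G, ∫⁻ w, f w ∂walkOn G ∂μ :=
  Measure.lintegral_bind measurable_walkOn.aemeasurable hf.aemeasurable

theorem isProbabilityMeasure_walkLaw [IsProbabilityMeasure μ] :
    IsProbabilityMeasure (walkLaw μ) := by
  refine ⟨?_⟩
  rw [walkLaw, Measure.bind_apply MeasurableSet.univ measurable_walkOn.aemeasurable]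
  simp

theorem measurable_lintegral_walkOn {f : RootedPath → ℝ≥0∞} (hf : Measurable f) :
    Measurable fun G => ∫⁻ w, f w ∂walkOn G :=
  (Measure.measurable_lintegral hf).comp measurable_walkOn

theorem measurable_negLog_iterate_shift (hT : Measurable RootedPath.shift) (m k : ℕ) :
    Measurable fun w : RootedPath => RootedPath.negLog k (RootedPath.shift^[m] w) :=
  (RootedPath.measurable_negLog k).comp (hT.iterate m)

/-- As a difference of finite integrals against `walkOn G`, the information inherits measurability
in the graph. -/
theorem measurable_ofReal_info (hT : Measurable RootedPath.shift) (m k : ℕ) :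
    Measurable fun G : RootedGraph => ENNReal.ofReal (G.info G.root m k) := by
  have hm := measurable_negLog_iterate_shift hT m k
  have h : (fun G : RootedGraph => ENNReal.ofReal (G.info G.root m k)) = fun G =>
      ∫⁻ w, ENNReal.ofReal (RootedPath.negLog (m + k) w) ∂walkOn G -
        ∫⁻ w, ENNReal.ofReal (RootedPath.negLog k (RootedPath.shift^[m] w)) ∂walkOn G :=
    funext fun G => ENNReal.eq_sub_of_add_eq (lintegral_negLog_iterate_shift_ne_top G hm)
      (ofReal_info_add G hm)
  rw [h]
  exact (measurable_lintegral_walkOn (RootedPath.measurable_negLog _).ennreal_ofReal).sub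
    (measurable_lintegral_walkOn hm.ennreal_ofReal)

theorem lintegral_info_add (hT : MeasurePreserving RootedPath.shift (walkLaw μ) (walkLaw μ))
    (m k : ℕ) :
    ∫⁻ G : RootedGraph, ENNReal.ofReal (G.info G.root m k) ∂μ + meanEntropy μ k =
      meanEntropy μ (m + k) := by
  have hm := measurable_negLog_iterate_shift hT.measurable m k
  have h1 : meanEntropy μ k = ∫⁻ G, ∫⁻ w, ENNReal.ofReal
      (RootedPath.negLog k (RootedPath.shift^[m] w)) ∂walkOn G ∂μ := by
    rw [← lintegral_walkLaw hm.ennreal_ofReal, meanEntropy]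
    exact ((hT.iterate m).lintegral_comp
      (RootedPath.measurable_negLog k).ennreal_ofReal).symm
  rw [h1, ← lintegral_add_left (measurable_ofReal_info hT.measurable m k), meanEntropy,
    lintegral_walkLaw (RootedPath.measurable_negLog _).ennreal_ofReal]
  exact lintegral_congr fun G => ofReal_info_add G hm

/-- Some mean with n ≥ 1 is finite, and the information identity shows that it dominates the mean at
time 1. -/
theorem meanEntropy_one_ne_top (hT : MeasurePreserving RootedPath.shift (walkLaw μ) (walkLaw μ))
    (hfin : FiniteEntropy μ) : meanEntropy μ 1 ≠ ∞ := by
  have hfreq : ∃ᶠ n : ℕ in atTop, meanEntropy μ n / (n : ℝ≥0∞) < ∞ :=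
    frequently_lt_of_liminf_lt (by isBoundedDefault) hfin
  obtain ⟨n, hn, hn1⟩ := (hfreq.and_eventually (eventually_ge_atTop 1)).exists
  obtain ⟨m, rfl⟩ : ∃ m, n = m + 1 := ⟨n - 1, by omega⟩
  have hlt : meanEntropy μ (m + 1) ≠ ∞ := by
    intro h
    rw [h, ENNReal.top_div_of_ne_top (ENNReal.natCast_ne_top _)] at hn
    exact lt_irrefl _ hn
  rw [← lintegral_info_add hT] at hlt
  exact (ENNReal.add_ne_top.1 hlt).2

theorem tendsto_lintegral_info
    (hT : MeasurePreserving RootedPath.shift (walkLaw μ) (walkLaw μ)) {m : ℕ}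
    (hm : meanEntropy μ m ≠ ∞) :
    Tendsto (fun k => ∫⁻ G : RootedGraph, ENNReal.ofReal (G.info G.root m k) ∂μ) atTop
      (𝓝 (∫⁻ G, G.infoTail m ∂μ)) := by
  refine tendsto_lintegral_of_dominated_convergence
    (fun G => ∫⁻ w, ENNReal.ofReal (RootedPath.negLog m w) ∂walkOn G)
    (fun k => measurable_ofReal_info hT.measurable m k)
    (fun k => Eventually.of_forall fun G =>
      ofReal_info_le G (measurable_negLog_iterate_shift hT.measurable m k)) ?_
    (Eventually.of_forall fun G => G.tendsto_info G.root m)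
  rwa [← lintegral_walkLaw (RootedPath.measurable_negLog m).ennreal_ofReal]

theorem le_integral_negLog_add [IsProbabilityMeasure μ]
    (hT : MeasurePreserving RootedPath.shift (walkLaw μ) (walkLaw μ))
    (hint : ∀ n, Integrable (RootedPath.negLog n) (walkLaw μ)) (m k : ℕ) :
    ∫ w, RootedPath.negLog (m + k) w ∂walkLaw μ ≤
      ∫ w, RootedPath.negLog m w ∂walkLaw μ + ∫ w, RootedPath.negLog k w ∂walkLaw μ := by
  have hi : Integrable (fun w => RootedPath.negLog k (RootedPath.shift^[m] w)) (walkLaw μ) := by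
    have h := (hT.iterate m).integrable_comp_of_integrable (hint k)
    simpa only [Function.comp_def] using h
  rw [← SubadditiveErgodic.integral_comp_of_measurePreserving (hT.iterate m)
    (hint k).aestronglyMeasurable, ← integral_add (hint m) hi]
  exact integral_mono (hint _) ((hint m).add hi) fun w => RootedPath.negLog_add_le m k w

theorem lintegral_infoTail_eq [IsProbabilityMeasure μ]
    (hT : MeasurePreserving RootedPath.shift (walkLaw μ) (walkLaw μ))
    (hint : ∀ n, Integrable (RootedPath.negLog n) (walkLaw μ)) {h : ℝ}
    (hlim : Tendsto (fun n : ℕ => (∫ w, RootedPath.negLog n w ∂walkLaw μ) / n) atTop (𝓝 h))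
    {m : ℕ} (hm : 1 ≤ m) :
    ∫⁻ G, G.infoTail m ∂μ = ENNReal.ofReal (m * h) := by
  obtain ⟨a, ha⟩ : ∃ a : ℕ → ℝ, ∀ n, ∫ w, RootedPath.negLog n w ∂walkLaw μ = a n :=
    ⟨_, fun _ => rfl⟩
  have hmean : ∀ n, meanEntropy μ n = ENNReal.ofReal (a n) := fun n => by
    rw [← ha]
    exact (ofReal_integral_eq_lintegral_ofReal (hint n)
      (Eventually.of_forall fun w => RootedPath.negLog_nonneg n w)).symm
  have ha0 : ∀ n, 0 ≤ a n := fun n => by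
    rw [← ha]
    exact integral_nonneg fun w => RootedPath.negLog_nonneg n w
  have h0 : a 0 = 0 := by
    rw [← ha]
    simp [RootedPath.negLog_zero]
  have hadd : ∀ k, a (m + k) ≤ a m + a k := fun k => by
    simpa only [ha] using le_integral_negLog_add hT hint m k
  simp only [ha] at hlim
  have hinfo : ∀ k, ∫⁻ G : RootedGraph, ENNReal.ofReal (G.info G.root m k) ∂μ =
      ENNReal.ofReal (a (m + k) - a k) := by
    intro k
    rw [ENNReal.ofReal_sub _ (ha0 k), ← hmean, ← hmean]
    exact ENNReal.eq_sub_of_add_eq (by rw [hmean]; exact ENNReal.ofReal_ne_top)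
      (lintegral_info_add hT m k)
  -- Nonnegative increments let the extended-real limit be read as a real one without truncation by
  -- `ENNReal.ofReal`.
  have hnn : ∀ k, 0 ≤ a (m + k) - a k := by
    intro k
    have h1 : meanEntropy μ k ≤ meanEntropy μ (m + k) := by
      rw [← lintegral_info_add hT m k]
      exact le_add_self
    rw [hmean, hmean, ENNReal.ofReal_le_ofReal_iff (ha0 _)] at h1
    linarith
  have htend := tendsto_lintegral_info hT (m := m) (by rw [hmean]; exact ENNReal.ofReal_ne_top)
  simp only [hinfo] at htend
  have hI : ∫⁻ G, G.infoTail m ∂μ ≠ ∞ :=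
    (lt_of_le_of_lt (le_of_tendsto' htend fun k => ENNReal.ofReal_le_ofReal
      (show a (m + k) - a k ≤ a m by linarith [hadd k])) ENNReal.ofReal_lt_top).ne
  have hreal : Tendsto (fun k => a (m + k) - a k) atTop (𝓝 (∫⁻ G, G.infoTail m ∂μ).toReal) := by
    refine ((ENNReal.tendsto_toReal hI).comp htend).congr fun k => ?_
    rw [Function.comp_apply, ENNReal.toReal_ofReal (hnn k)]
  rw [← eq_mul_of_tendsto_sub_of_tendsto_div h0 hm hreal hlim, ENNReal.ofReal_toReal hI]

end Stationary

end StatGraph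

theorem mainTheorem9 (μ : MeasureTheory.Measure StatGraph.RootedGraph)
    [MeasureTheory.IsProbabilityMeasure μ] (hstat : StatGraph.IsStationary μ)
    (herg : StatGraph.IsErgodic μ) (hfin : StatGraph.FiniteEntropy μ) :
    ∃ h : ℝ, StatGraph.IsEntropy μ h ∧
      ∀ m : ℕ, 1 ≤ m → ENNReal.ofReal h = ∫⁻ G, G.infoTail m / (m : ℝ≥0∞) ∂μ := by
  have hT : MeasurePreserving StatGraph.RootedPath.shift (StatGraph.walkLaw μ)
    (StatGraph.walkLaw μ) := herg.toMeasurePreserving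
  have := StatGraph.isProbabilityMeasure_walkLaw (μ := μ)
  have hmeas := StatGraph.RootedPath.measurable_negLog
  have hint1 : Integrable (StatGraph.RootedPath.negLog 1) (StatGraph.walkLaw μ) := by
    refine (lintegral_ofReal_ne_top_iff_integrable (hmeas 1).aestronglyMeasurable
      (Eventually.of_forall fun w => w.negLog_nonneg 1)).1 ?_
    exact StatGraph.meanEntropy_one_ne_top hT hfin
  have hint := SubadditiveErgodic.integrable_of_subadditive hT hmeas
    StatGraph.RootedPath.negLog_zero StatGraph.RootedPath.negLog_nonneg
    StatGraph.RootedPath.negLog_add_le hint1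
  obtain ⟨h, -, hae, hL1⟩ := SubadditiveErgodic.exists_tendsto herg hmeas
    StatGraph.RootedPath.negLog_zero StatGraph.RootedPath.negLog_nonneg
    StatGraph.RootedPath.negLog_add_le hint1
  have hdi : ∀ n : ℕ, Integrable (fun w : StatGraph.RootedPath => w.negLog n / n - h)
      (StatGraph.walkLaw μ) := fun n => ((hint n).div_const _).sub (integrable_const h)
  refine ⟨h, ⟨hae, ?_⟩, fun m hm => ?_⟩
  · refine (ENNReal.ofReal_zero ▸ ENNReal.tendsto_ofReal hL1).congr fun n => ?_
    rw [eLpNorm_one_eq_lintegral_enorm, ← ofReal_integral_norm_eq_lintegral_enorm (hdi n)]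
    rfl
  -- L¹ convergence identifies the almost sure limit `h` with the limit of the means, which the
  -- information identity controls.
  · have hlim : Tendsto (fun n : ℕ => (∫ w, StatGraph.RootedPath.negLog n w
        ∂StatGraph.walkLaw μ) / n) atTop (𝓝 h) := by
      rw [tendsto_iff_dist_tendsto_zero]
      refine squeeze_zero (fun _ => dist_nonneg) (fun n => ?_) hL1
      have h1 : (∫ w, StatGraph.RootedPath.negLog n w ∂StatGraph.walkLaw μ) / n - h =
          ∫ w, (StatGraph.RootedPath.negLog n w / n - h) ∂StatGraph.walkLaw μ := by
        rw [integral_sub ((hint n).div_const _) (integrable_const h), integral_div]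
        simp
      rw [Real.dist_eq, h1]
      exact abs_integral_le_integral_abs
    have hm0 : (m : ℝ≥0∞) ≠ 0 := by exact_mod_cast (by omega : m ≠ 0)
    simp only [div_eq_mul_inv]
    rw [lintegral_mul_const' _ _ (ENNReal.inv_ne_top.2 hm0),
      StatGraph.lintegral_infoTail_eq hT hint hlim hm, ENNReal.ofReal_mul m.cast_nonneg,
      ENNReal.ofReal_natCast, mul_comm, ← mul_assoc,
      ENNReal.inv_mul_cancel hm0 (ENNReal.natCast_ne_top m), one_mul]
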